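/- Let $X$ be a real Banach space that is a predual of $\ell_1$, i.e. $X^*$ is identified with $\ell_1$ through a fixed linear isometry of $X^*$ onto $\ell_1$, and let $\sigma(\ell_1,X)$ be the corresponding weak* topology on $\ell_1$. For a class $\mathcal P$ of maps, $\ell_1$ has the $\sigma(\ell_1,X)$-fixed point property (FPP) for maps in $\mathcal P$ if for every nonempty convex $\sigma(\ell_1,X)$-compact set $C\subset\ell_1$, every map $T:C\to C$ in $\mathcal P$ has a fixed point; otherwise $\ell_1$ lacks it. A map $T:C\to C$ is nonexpansive if $\|Tx-Ty\|\le\|x-y\|$ for all $x,y\in C$, an isometry if $\|Tx-Ty\|=\|x-y\|$ for all $x,y\in C$, and contractive if $\|Tx-Ty\|<\|x-y\|$ for all $x,y\in C$ with $x\ne y$. Let $c$ be the space of convergent real sequences $x=(x(1),x(2),\dots)$ with the supremum norm. An element $f=(f(1),f(2),\dots)\in\ell_1$ acts on $c$ by $f(x)=f(1)\lim_{n}x(n)+\sum_{n=1}^\infty f(n+1)x(n)$, and $W_f=\{x\in c: f(x)=0\}$. The space $W_f$ is called bad if $\|f\|=1$, $|f(1)|=\tfrac12$ and the set $\{n\ge1: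 f(1)f(n+1)\le0\}$ is infinite. Then the following are equivalent. 1. $\ell_1$ lacks the $\sigma(\ell_1,X)$-FPP for nonexpansive maps. 2. $\ell_1$ lacks the $\sigma(\ell_1,X)$-FPP for isometries. 3. $\ell_1$ lacks the $\sigma(\ell_1,X)$-FPP for contractive maps. 4. There is a subsequence $(e^*_{n_k})_{k}$ of the standard basis $(e^*_n)_n$ of $\ell_1$ which is $\sigma(\ell_1,X)$-convergent to some $e^*\in\ell_1$ with $\|e^*\|=1$ and $e^*(n_k)\ge0$ for all $k$. 5. There are a closed subspace $Y$ of $X$ and a bad $W_f$ such that the quotient $X/Y$ is linearly isometric to $W_f$. 6. There are a closed subspace $Y$ of $X$ and a bad $W_g$ such that $X/Y$ contains a subspace linearly isometric to $W_g$. -/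

import Mathlib

open Filter Topology
open scoped ENNReal

noncomputable section

namespace WeakStarFPP

/-- The real Banach space `ℓ₁`; coordinates are indexed from `0`. -/
abbrev Ell1 : Type := lp (fun _ : ℕ => ℝ) 1

/-- The real Banach space `ℓ_∞` with the supremum norm. -/
abbrev EllInf : Type := lp (fun _ : ℕ => ℝ) ∞

/-- The space `c` of convergent real sequences, with the supremum norm inherited from `ℓ_∞`. -/
def spaceC : Submodule ℝ EllInf where
  carrier := {x | ∃ l : ℝ, Tendsto (fun n => x n) atTop (𝓝 l)}
  add_mem' := by
    rintro x y ⟨a, ha⟩ ⟨b, hb⟩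
    exact ⟨a + b, by simpa using ha.add hb⟩
  zero_mem' := ⟨0, by simp⟩
  smul_mem' := by
    rintro r x ⟨a, ha⟩
    exact ⟨r * a, by simpa using ha.const_mul r⟩

/-- The limit of a convergent sequence. -/
def limC (x : spaceC) : ℝ := x.2.choose

theorem tendsto_limC (x : spaceC) :
    Tendsto (fun n => (x : EllInf) n) atTop (𝓝 (limC x)) := x.2.choose_spec

theorem limC_add (x y : spaceC) : limC (x + y) = limC x + limC y :=
  tendsto_nhds_unique (tendsto_limC (x + y))
    (by simpa using (tendsto_limC x).add (tendsto_limC y))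

theorem limC_smul (r : ℝ) (x : spaceC) : limC (r • x) = r * limC x :=
  tendsto_nhds_unique (tendsto_limC (r • x))
    (by simpa using (tendsto_limC x).const_mul r)

theorem summable_pairing (f : Ell1) (x : spaceC) :
    Summable fun n : ℕ => f (n + 1) * (x : EllInf) n := by
  have hf : Summable fun n : ℕ => ‖f n‖ := by
    simpa using (lp.memℓp f).summable (by simp)
  refine Summable.of_norm_bounded
    (((summable_nat_add_iff 1).2 hf).mul_right ‖(x : EllInf)‖) fun n => ?_
  rw [norm_mul]
  exact mul_le_mul_of_nonneg_left
    (lp.norm_apply_le_norm ENNReal.top_ne_zero (x : EllInf) n) (norm_nonneg _)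

/-- The action of `f ∈ ℓ₁ = c*` on `c`: the coordinate of `f` with index `0` multiplies the limit
of the sequence, and the one with index `n + 1` multiplies its term with index `n`. -/
def pairing (f : Ell1) : spaceC →ₗ[ℝ] ℝ where
  toFun x := f 0 * limC x + ∑' n : ℕ, f (n + 1) * (x : EllInf) n
  map_add' x y := by
    have h := (summable_pairing f x).tsum_add (summable_pairing f y)
    have e : (∑' n : ℕ, f (n + 1) * ((x + y : spaceC) : EllInf) n) =
        ∑' n : ℕ, (f (n + 1) * (x : EllInf) n + f (n + 1) * (y : EllInf) n) :=
      tsum_congr fun n => by simp [mul_add]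
    rw [e, h, limC_add]
    ring
  map_smul' r x := by
    have e : (∑' n : ℕ, f (n + 1) * ((r • x : spaceC) : EllInf) n) =
        ∑' n : ℕ, r * (f (n + 1) * (x : EllInf) n) :=
      tsum_congr fun n => by simp [mul_left_comm]
    rw [e, tsum_mul_left, limC_smul]
    simp only [RingHom.id_apply, smul_eq_mul]
    ring

/-- The hyperplane `W_f = {x ∈ c : f(x) = 0}` of `c`, with the supremum norm. -/
def W (f : Ell1) : Submodule ℝ spaceC := LinearMap.ker (pairing f)

/-- `W_f` is "bad". -/
def IsBad (f : Ell1) : Prop :=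
  ‖f‖ = 1 ∧ |f 0| = 1 / 2 ∧ {n : ℕ | f 0 * f (n + 1) ≤ 0}.Infinite

variable {X : Type*} [NormedAddCommGroup X] [NormedSpace ℝ X]

/-- The topology `σ(ℓ₁, X)` on `ℓ₁`, where `ℓ₁` is identified with `X*` through `φ`. -/
abbrev weakStar (φ : StrongDual ℝ X ≃ₗᵢ[ℝ] Ell1) : TopologicalSpace Ell1 :=
  TopologicalSpace.induced (fun g => StrongDual.toWeakDual (φ.symm g))
    (inferInstance : TopologicalSpace (WeakDual ℝ X))

/-- `ℓ₁` has the `σ(ℓ₁, X)`-fixed point property for the self-maps of class `P`: every map of class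
`P` of a nonempty, convex, `σ(ℓ₁, X)`-compact set into itself has a fixed point. -/
def HasFPP (φ : StrongDual ℝ X ≃ₗᵢ[ℝ] Ell1) (P : ∀ C : Set Ell1, (C → C) → Prop) : Prop :=
  ∀ C : Set Ell1, C.Nonempty → Convex ℝ C → @IsCompact Ell1 (weakStar φ) C →
    ∀ T : C → C, P C T → ∃ x : C, T x = x

/-- `‖T x - T y‖ ≤ ‖x - y‖` for all `x`, `y`. -/
def Nonexpansive (C : Set Ell1) (T : C → C) : Prop :=
  ∀ x y : C, ‖(T x : Ell1) - T y‖ ≤ ‖(x : Ell1) - y‖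

/-- `‖T x - T y‖ = ‖x - y‖` for all `x`, `y` (surjectivity is not required). -/
def Isometric (C : Set Ell1) (T : C → C) : Prop :=
  ∀ x y : C, ‖(T x : Ell1) - T y‖ = ‖(x : Ell1) - y‖

/-- `‖T x - T y‖ < ‖x - y‖` for all `x ≠ y`. -/
def Contractive (C : Set Ell1) (T : C → C) : Prop :=
  ∀ x y : C, x ≠ y → ‖(T x : Ell1) - T y‖ < ‖(x : Ell1) - y‖

/-- The standard basis of `ℓ₁`. -/
def stdBasis (n : ℕ) : Ell1 := lp.single 1 n (1 : ℝ)

end WeakStarFPP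

end

open Filter Topology
open scoped ENNReal

noncomputable section

namespace WeakStarFPP

variable {X : Type*} [NormedAddCommGroup X] [NormedSpace ℝ X]

section

/-! ### Coordinates of elements of `ℓ₁` -/

/-! Everything is routed through condition 4, named `HasNormOneLimit` below. The tool for reaching
it is `hasNormOneLimit_of_norming`: if vectors of the unit ball of `ℓ₁` tend to zero coordinatewise
and are asymptotically normed by one common sequence in `X`, then basis vectors carried by their
supports are normed, up to a sign, by a subsequence of it. A weak* limit of such basis vectors keeps
norm one and has nonnegative coordinates along the subsequence.

From 1: in a minimal weak* compact convex invariant set `K`, take almost fixed points converging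
coordinatewise to some `y`. The identity `‖u n - v‖ - ‖u n‖ → ‖v‖` shows that the map does not
increase the distance to `y`, so by minimality `K` lies on a sphere about `y`. Separating the
normalised `K` from slightly smaller balls yields vectors of `X` that almost norm all of `K`
simultaneously, and the tool applies.

From 4: the limit can be written as `D c`, with `D` an isometric copy of `ℓ₁` whose basis converges
weak* to `D c` and `c` in the simplex (`exists_isWeakStarCopy`). The image of the simplex is then
weak* compact, because mass escaping to infinity reappears at `c`. On it the right shift `S` is an
isometry without fixed points, and `∑ 2⁻ᵏ Sᵏ` over `k ≥ 1` is contractive without fixed points.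
Moreover `z ↦ (D eₙ (z))ₙ` is a quotient map of `X` onto the bad hyperplane given by `(1/2, -c/2)`,
since its adjoint preserves norms.

From 6: the coordinate functionals of the hyperplane extend to disjoint vectors in the ball of `ℓ₁`.
Vectors of the hyperplane that follow the signs of `c` and are nearly one afterwards, lifted to `X`,
norm them, and the tool applies again. -/

theorem hasSum_abs (f : Ell1) : HasSum (fun i => |f i|) ‖f‖ := by
  simpa using lp.hasSum_norm (by simp) f

theorem summable_abs (f : Ell1) : Summable fun i => |f i| := (hasSum_abs f).summable

theorem summable_coord (f : Ell1) : Summable fun i => f i := (summable_abs f).of_abs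

theorem abs_apply_le (f : Ell1) (i : ℕ) : |f i| ≤ ‖f‖ :=
  lp.norm_apply_le_norm one_ne_zero f i

/-- The element of `ℓ₁` with the given absolutely summable coordinates. -/
def ofSummable (a : ℕ → ℝ) (ha : Summable fun i => |a i|) : Ell1 :=
  ⟨a, memℓp_gen (by simpa using ha)⟩

theorem stdBasis_apply (n i : ℕ) : stdBasis n i = if i = n then 1 else 0 := by
  simp [stdBasis, lp.single_apply, Pi.single_apply]

theorem norm_stdBasis (n : ℕ) : ‖stdBasis n‖ = 1 := by
  simp [stdBasis, lp.norm_single]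

theorem hasSum_smul_stdBasis (f : Ell1) : HasSum (fun i => f i • stdBasis i) f := by
  have h := lp.hasSum_single (p := 1) (by simp) f
  refine h.congr_fun fun i => ?_
  rw [stdBasis, ← lp.single_smul, smul_eq_mul, mul_one]

/-! ### The duality between `ℓ₁` and `X` -/

variable (φ : StrongDual ℝ X ≃ₗᵢ[ℝ] Ell1)

theorem hasSum_dual_apply (x : Ell1) (z : X) :
    HasSum (fun i => x i * φ.symm (stdBasis i) z) (φ.symm x z) := by
  have h := (hasSum_smul_stdBasis x).mapL
    ((ContinuousLinearMap.apply ℝ ℝ z).comp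
      (φ.symm.toContinuousLinearEquiv : Ell1 →L[ℝ] StrongDual ℝ X))
  simpa using h

theorem abs_dual_apply_le (x : Ell1) (z : X) : |φ.symm x z| ≤ ‖x‖ * ‖z‖ := by
  simpa using (φ.symm x).le_opNorm z

theorem dual_apply_le (x : Ell1) (z : X) : φ.symm x z ≤ ‖x‖ * ‖z‖ :=
  (le_abs_self _).trans (abs_dual_apply_le φ x z)

theorem abs_stdBasis_apply_le (i : ℕ) (z : X) : |φ.symm (stdBasis i) z| ≤ ‖z‖ := by
  simpa [norm_stdBasis] using abs_dual_apply_le φ (stdBasis i) z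

/-- `ℓ₁` as a set of functionals on `X`, with the weak* topology. -/
def toWeak : Ell1 ≃ₗ[ℝ] WeakDual ℝ X :=
  φ.symm.toLinearEquiv.trans StrongDual.toWeakDual

@[simp]
theorem toWeak_apply (g : Ell1) (z : X) : toWeak φ g z = φ.symm g z := rfl

theorem isInducing_toWeak : @IsInducing Ell1 (WeakDual ℝ X) (weakStar φ) _ (toWeak φ) :=
  @IsInducing.mk _ _ (weakStar φ) _ _ rfl

theorem isCompact_weakStar_iff {C : Set Ell1} :
    @IsCompact Ell1 (weakStar φ) C ↔ IsCompact (toWeak φ '' C) :=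
  letI := weakStar φ
  (isInducing_toWeak φ).isCompact_iff

theorem tendsto_weakStar_iff {ι : Type*} {l : Filter ι} {g : ι → Ell1} {e : Ell1} :
    Tendsto g l (@nhds Ell1 (weakStar φ) e) ↔
      ∀ z : X, Tendsto (fun k => φ.symm (g k) z) l (𝓝 (φ.symm e z)) := by
  have h : @nhds Ell1 (weakStar φ) e = comap (toWeak φ) (𝓝 (toWeak φ e)) := nhds_induced _ _
  rw [h, tendsto_comap_iff, tendsto_iff_forall_eval_tendsto_topDualPairing]
  rfl

theorem continuous_toWeak : Continuous (toWeak φ) :=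
  NormedSpace.Dual.toWeakDual_continuous.comp φ.symm.continuous

theorem isCompact_toWeak_closedBall (y : Ell1) (r : ℝ) :
    IsCompact (toWeak φ '' Metric.closedBall y r) := by
  have h := WeakDual.isCompact_closedBall (φ.symm y) r
  convert h using 1
  ext g
  simp only [Set.mem_image, Set.mem_preimage, Metric.mem_closedBall]
  constructor
  · rintro ⟨x, hx, rfl⟩
    exact (φ.symm.dist_map x y).trans_le hx
  · intro hg
    refine ⟨φ (WeakDual.toStrongDual g), ?_, ?_⟩
    · rw [← φ.symm.dist_map]; simpa using hg
    · exact DFunLike.ext _ _ fun z => by simp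

/-- A weak* continuous functional is the evaluation at a point of the predual. -/
theorem exists_eval_eq (f : StrongDual ℝ (WeakDual ℝ X)) : ∃ z : X, ∀ g, f g = g z := by
  obtain ⟨z, hz⟩ := LinearMap.dualEmbedding_surjective (topDualPairing ℝ X) f
  exact ⟨z, fun g => by rw [← hz]; rfl⟩

theorem separableSpace_ell1 : TopologicalSpace.SeparableSpace Ell1 := by
  have h : (Submodule.span ℝ (Set.range stdBasis)).topologicalClosure = ⊤ := by
    rw [eq_top_iff]
    rintro f -
    refine mem_closure_of_tendsto (hasSum_smul_stdBasis f) (Eventually.of_forall fun s => ?_)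
    exact Submodule.sum_mem _ fun i _ =>
      Submodule.smul_mem _ _ (Submodule.subset_span ⟨i, rfl⟩)
  have hs := ((Set.countable_range stdBasis).isSeparable.span (R := ℝ)).closure
  rw [← Submodule.topologicalClosure_coe, h] at hs
  exact TopologicalSpace.isSeparable_univ_iff.1 hs

/-- A normed space with separable dual is separable. -/
theorem separableSpace_of_dual [TopologicalSpace.SeparableSpace (StrongDual ℝ X)] :
    TopologicalSpace.SeparableSpace X := by
  let f := TopologicalSpace.denseSeq (StrongDual ℝ X)
  have hx : ∀ n, ∃ x : X, ‖x‖ ≤ 1 ∧ ‖f n‖ / 2 ≤ ‖f n x‖ := by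
    intro n
    by_cases h0 : ‖f n‖ = 0
    · exact ⟨0, by simp, by simp [h0]⟩
    by_contra! hc
    have : ‖f n‖ ≤ ‖f n‖ / 2 := by
      refine (f n).opNorm_le_of_unit_norm (by positivity) fun x hx => ?_
      exact (hc x hx.le).le
    have := norm_nonneg (f n)
    exact h0 (by linarith)
  choose x hx1 hx2 using hx
  let p := (Submodule.span ℝ (Set.range x)).topologicalClosure
  have hp : p = ⊤ := by
    by_contra hne
    obtain ⟨v, hv⟩ : ∃ v, v ∉ p := by
      by_contra! h
      exact hne (eq_top_iff.2 fun v _ => h v)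
    obtain ⟨g, hg0, hg⟩ : ∃ g : StrongDual ℝ X, g v ≠ 0 ∧ ∀ w ∈ p, g w = 0 := by
      obtain ⟨g, u, hgu, huv⟩ := geometric_hahn_banach_closed_point
        (s := (p : Set X)) p.convex (Submodule.isClosed_topologicalClosure _) hv
      have hz : ∀ w ∈ p, g w = 0 := by
        intro w hw
        by_contra hgw
        have := hgu _ (p.smul_mem (u / g w) hw)
        simp [hgw] at this
      refine ⟨g, ?_, hz⟩
      have := hgu 0 p.zero_mem
      simp at this
      linarith
    have hgn : 0 < ‖g‖ := by
      rw [norm_pos_iff]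
      rintro rfl
      simp at hg0
    obtain ⟨n, hn⟩ := (TopologicalSpace.denseRange_denseSeq (StrongDual ℝ X)).exists_dist_lt g
      (show 0 < ‖g‖ / 4 by positivity)
    have hn' : ‖g - f n‖ < ‖g‖ / 4 := by rwa [← dist_eq_norm]
    have h1 : g (x n) = 0 :=
      hg _ (Submodule.le_topologicalClosure _ (Submodule.subset_span ⟨n, rfl⟩))
    have h2 : ‖(g - f n) (x n)‖ ≤ ‖g - f n‖ * 1 :=
      (g - f n).le_opNorm_of_le (hx1 n)
    have h3 : ‖(g - f n) (x n)‖ = ‖f n (x n)‖ := by simp [h1]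
    have h4 := hx2 n
    have h5 : ‖g‖ ≤ ‖g - f n‖ + ‖f n‖ := by simpa using norm_add_le (g - f n) (f n)
    linarith
  have hs := ((Set.countable_range x).isSeparable.span (R := ℝ)).closure
  rw [← Submodule.topologicalClosure_coe] at hs
  change TopologicalSpace.IsSeparable (p : Set X) at hs
  rw [hp] at hs
  exact TopologicalSpace.isSeparable_univ_iff.1 hs

/-- Separability of `X` makes the dual ball weak* sequentially compact, so that subsequences suffice
in place of nets. -/
theorem separableSpace_predual (φ : StrongDual ℝ X ≃ₗᵢ[ℝ] Ell1) :
    TopologicalSpace.SeparableSpace X := by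
  have := separableSpace_ell1
  have : TopologicalSpace.SeparableSpace (StrongDual ℝ X) :=
    φ.symm.surjective.denseRange.separableSpace φ.symm.continuous
  exact separableSpace_of_dual

/-- A bounded sequence in `ℓ₁` has a weak* convergent subsequence. -/
theorem exists_subseq_tendsto_weakStar {g : ℕ → Ell1} (hg : ∀ n, ‖g n‖ ≤ 1) :
    ∃ (e : Ell1) (s : ℕ → ℕ), StrictMono s ∧ ∀ z : X,
      Tendsto (fun k => φ.symm (g (s k)) z) atTop (𝓝 (φ.symm e z)) := by
  have := separableSpace_predual φ
  obtain ⟨a, -, s, hs, ha⟩ := WeakDual.isSeqCompact_closedBall ℝ X 0 1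
    (x := fun n => toWeak φ (g n)) (fun n => by
      simpa [toWeak] using hg n)
  refine ⟨(toWeak φ).symm a, s, hs, fun z => ?_⟩
  rw [tendsto_iff_forall_eval_tendsto_topDualPairing] at ha
  change Tendsto _ _ (𝓝 (toWeak φ ((toWeak φ).symm a) z))
  rw [LinearEquiv.apply_symm_apply]
  exact ha z

end

section

/-! ### Subsequences of the standard basis from norming sequences -/

/-- A subsequence of the standard basis converges weak* to an element of norm one whose coordinates
along this subsequence are nonnegative. -/
def HasNormOneLimit (φ : StrongDual ℝ X ≃ₗᵢ[ℝ] Ell1) : Prop :=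
  ∃ n : ℕ → ℕ, StrictMono n ∧ ∃ e : Ell1, ‖e‖ = 1 ∧
    Tendsto (fun k => stdBasis (n k)) atTop (@nhds Ell1 (weakStar φ) e) ∧ ∀ k, 0 ≤ e (n k)

variable (φ : StrongDual ℝ X ≃ₗᵢ[ℝ] Ell1)

/-- The term at `i` measures how far `z` is from attaining the sign of `x i` on the basis vector.
For `‖z‖ ≤ 1` all terms are nonnegative, so a nearly norming `z` is controlled at every single
coordinate. -/
theorem hasSum_defect (x : Ell1) (z : X) :
    HasSum (fun i => |x i| - x i * φ.symm (stdBasis i) z) (‖x‖ - φ.symm x z) :=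
  (hasSum_abs x).sub (hasSum_dual_apply φ x z)

theorem defect_nonneg (x : Ell1) {z : X} (hz : ‖z‖ ≤ 1) (i : ℕ) :
    0 ≤ |x i| - x i * φ.symm (stdBasis i) z := by
  have h1 : |x i * φ.symm (stdBasis i) z| ≤ |x i| * 1 := by
    rw [abs_mul]
    exact mul_le_mul_of_nonneg_left ((abs_stdBasis_apply_le φ i z).trans hz) (abs_nonneg _)
  linarith [le_abs_self (x i * φ.symm (stdBasis i) z)]

theorem defect_le (x : Ell1) {z : X} (hz : ‖z‖ ≤ 1) (i : ℕ) :
    |x i| - x i * φ.symm (stdBasis i) z ≤ ‖x‖ - φ.symm x z :=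
  le_hasSum (hasSum_defect φ x z) i fun j _ => defect_nonneg φ x hz j

/-- An element of the unit ball of `ℓ₁` almost normed by finitely many vectors has a coordinate,
outside a set of small mass, at which all these vectors almost attain the right sign. -/
theorem exists_coord_of_almost_norming {x : Ell1} {z : ℕ → X} (hx : ‖x‖ ≤ 1)
    (hz : ∀ j, ‖z j‖ ≤ 1) (k N : ℕ) (hxz : ∀ j ≤ k, 1 - (1 / 4) ^ (j + 2) ≤ φ.symm x (z j))
    (hN : ∑ i ∈ Finset.range N, |x i| ≤ 1 / 4) :
    ∃ i, N ≤ i ∧ x i ≠ 0 ∧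
      ∀ j ≤ k, |x i| - x i * φ.symm (stdBasis i) (z j) ≤ (1 / 2) ^ j * |x i| := by
  -- With the weights `2 ^ j` a coordinate `i ≥ N` that fails for some `j ≤ k` satisfies `|x i| ≤ G
  -- i`, while `G` has total mass at most `1/8`. If all failed, then `‖x‖ ≤ 1/8 + 1/4`, against `‖x‖
  -- ≥ 1 - 1/16`.
  set G : ℕ → ℝ := fun i => ∑ j ∈ Finset.range (k + 1),
    2 ^ j * (|x i| - x i * φ.symm (stdBasis i) (z j)) with hG
  have hGs : HasSum G (∑ j ∈ Finset.range (k + 1), 2 ^ j * (‖x‖ - φ.symm x (z j))) :=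
    hasSum_sum fun j _ => (hasSum_defect φ x (z j)).mul_left _
  have hterm : ∀ i j, 0 ≤ (2 : ℝ) ^ j * (|x i| - x i * φ.symm (stdBasis i) (z j)) := fun i j =>
    mul_nonneg (by positivity) (defect_nonneg φ x (hz j) i)
  have hbound : ∑ j ∈ Finset.range (k + 1), 2 ^ j * (‖x‖ - φ.symm x (z j)) ≤ 1 / 8 := by
    calc ∑ j ∈ Finset.range (k + 1), 2 ^ j * (‖x‖ - φ.symm x (z j))
        ≤ ∑ j ∈ Finset.range (k + 1), 1 / 16 * (1 / 2 : ℝ) ^ j := by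
          refine Finset.sum_le_sum fun j hj => ?_
          have h1 := hxz j (Nat.lt_succ_iff.1 (Finset.mem_range.1 hj))
          calc (2 : ℝ) ^ j * (‖x‖ - φ.symm x (z j)) ≤ 2 ^ j * (1 / 4) ^ (j + 2) :=
                mul_le_mul_of_nonneg_left (by linarith) (by positivity)
            _ = 1 / 16 * (1 / 2 : ℝ) ^ j := by
                rw [pow_add, ← mul_assoc, ← mul_pow]; norm_num [mul_comm]
      _ = 1 / 16 * ∑ j ∈ Finset.range (k + 1), (1 / 2 : ℝ) ^ j := by rw [Finset.mul_sum]
      _ ≤ 1 / 16 * 2 := by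
          have := sum_geometric_two_le (k + 1)
          linarith
      _ = 1 / 8 := by norm_num
  by_contra! hc
  have hle : ∀ i, |x i| ≤ G i + if i ∈ Finset.range N then |x i| else 0 := by
    intro i
    have hG0 : 0 ≤ G i := Finset.sum_nonneg fun j _ => hterm i j
    by_cases hi : i ∈ Finset.range N
    · simp only [hi, if_true]; linarith
    simp only [hi, if_false, add_zero]
    by_cases hxi : x i = 0
    · simpa [hxi] using hG0
    obtain ⟨j, hj, hlt⟩ := hc i (by simpa using hi) hxi
    have h1 : |x i| ≤ 2 ^ j * (|x i| - x i * φ.symm (stdBasis i) (z j)) := by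
      calc |x i| = 2 ^ j * ((1 / 2) ^ j * |x i|) := by
            rw [← mul_assoc, ← mul_pow]; norm_num
        _ ≤ _ := mul_le_mul_of_nonneg_left hlt.le (by positivity)
    exact h1.trans (Finset.single_le_sum (f := fun j => (2 : ℝ) ^ j *
      (|x i| - x i * φ.symm (stdBasis i) (z j))) (fun j _ => hterm i j)
      (Finset.mem_range.2 (Nat.lt_succ_of_le hj)))
  have hsumN : HasSum (fun i => if i ∈ Finset.range N then |x i| else 0)
      (∑ i ∈ Finset.range N, |x i|) := by
    rw [← Finset.sum_congr rfl fun i hi =>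
      (if_pos hi : (if i ∈ Finset.range N then |x i| else 0) = |x i|)]
    exact hasSum_sum_of_ne_finset_zero fun i hi => if_neg hi
  have h1 := hasSum_le hle (hasSum_abs x) (hGs.add hsumN)
  have h2 := hxz 0 (Nat.zero_le k)
  have h3 : φ.symm x (z 0) ≤ ‖x‖ :=
    (dual_apply_le φ x (z 0)).trans (mul_le_of_le_one_right (norm_nonneg _) (hz 0))
  norm_num at h2
  linarith

theorem norm_le_one_of_tendsto {ι : Type*} {l : Filter ι} [l.NeBot] {g : ι → Ell1} {e : Ell1}
    (hg : ∀ k, ‖g k‖ ≤ 1)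
    (h : ∀ z : X, Tendsto (fun k => φ.symm (g k) z) l (𝓝 (φ.symm e z))) : ‖e‖ ≤ 1 := by
  rw [← φ.symm.norm_map]
  refine ContinuousLinearMap.opNorm_le_bound _ zero_le_one fun z => ?_
  refine le_of_tendsto (h z).norm (Eventually.of_forall fun k => ?_)
  exact (abs_dual_apply_le φ (g k) z).trans
    (mul_le_mul_of_nonneg_right (hg k) (norm_nonneg z))

/-- Elements of the unit ball of `ℓ₁` that tend to zero coordinatewise and are asymptotically normed
by a common sequence of `X` yield a subsequence of the standard basis with a weak* limit of norm
one. -/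
theorem hasNormOneLimit_of_norming {x : ℕ → Ell1} (hx : ∀ m, ‖x m‖ ≤ 1)
    (hx0 : ∀ i, Tendsto (fun m => x m i) atTop (𝓝 0)) {z : ℕ → X} (hz : ∀ j, ‖z j‖ ≤ 1)
    (hxz : ∀ m, Tendsto (fun j => φ.symm (x m) (z j)) atTop (𝓝 1)) {a : ℕ → ℝ}
    (ha : Tendsto a atTop (𝓝 1)) (hax : ∀ j, ∀ᶠ m in atTop, a j ≤ φ.symm (x m) (z j)) :
    HasNormOneLimit φ := by
  obtain ⟨r, hr, har⟩ : ∃ r : ℕ → ℕ, StrictMono r ∧ ∀ j, 1 - (1 / 4) ^ (j + 2) ≤ a (r j) := by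
    refine extraction_forall_of_eventually
      (P := fun j i => 1 - (1 / 4) ^ (j + 2) ≤ a i) fun j => ?_
    exact (ha.eventually (lt_mem_nhds (show 1 - (1 / 4 : ℝ) ^ (j + 2) < 1 by
      linarith [show (0 : ℝ) < (1 / 4) ^ (j + 2) by positivity]))).mono fun _ h => h.le
  set y : ℕ → X := fun j => z (r j) with hy
  have hy1 : ∀ j, ‖y j‖ ≤ 1 := fun j => hz _
  have hxy : ∀ m, Tendsto (fun j => φ.symm (x m) (y j)) atTop (𝓝 1) := fun m =>
    (hxz m).comp hr.tendsto_atTop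
  have hfreq : ∀ k, ∃ᶠ i in atTop, ∃ σ : ℝ, (σ = 1 ∨ σ = -1) ∧
      (∀ j ≤ k, 1 - (1 / 2) ^ j ≤ σ * φ.symm (stdBasis i) (y j)) ∧
      Tendsto (fun j => σ * φ.symm (stdBasis i) (y j)) atTop (𝓝 1) := by
    intro k
    rw [frequently_atTop]
    intro N
    have h1 : ∀ᶠ m in atTop, ∀ j ≤ k, a (r j) ≤ φ.symm (x m) (y j) :=
      (Set.finite_Iic k).eventually_all.2 fun j _ => hax (r j)
    have h2 : ∀ᶠ m in atTop, ∑ i ∈ Finset.range N, |x m i| ≤ 1 / 4 := by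
      have h : Tendsto (fun m => ∑ i ∈ Finset.range N, |x m i|) atTop (𝓝 0) := by
        simpa using tendsto_finsetSum (Finset.range N) fun i _ => (hx0 i).abs
      exact (h.eventually (gt_mem_nhds (show (0 : ℝ) < 1 / 4 by norm_num))).mono fun _ h => h.le
    obtain ⟨m, hm1, hm2⟩ := (h1.and h2).exists
    obtain ⟨i, hi, hxi, hj⟩ := exists_coord_of_almost_norming φ (hx m) hy1 k N
      (fun j hj => (har j).trans (hm1 j hj)) hm2
    have habs : 0 < |x m i| := abs_pos.2 hxi
    obtain ⟨σ, hσ, hσx⟩ : ∃ σ : ℝ, (σ = 1 ∨ σ = -1) ∧ x m i = |x m i| * σ := by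
      rcases abs_choice (x m i) with h | h
      · exact ⟨1, Or.inl rfl, by rw [h, mul_one]⟩
      · exact ⟨-1, Or.inr rfl, by rw [h]; ring⟩
    have hdef : ∀ j, |x m i| - x m i * φ.symm (stdBasis i) (y j) =
        |x m i| * (1 - σ * φ.symm (stdBasis i) (y j)) := by
      intro j
      nth_rewrite 2 [hσx]
      ring
    refine ⟨i, hi, σ, hσ, fun j hjk => ?_, ?_⟩
    · have := hj j hjk
      rw [hdef, mul_comm] at this
      linarith [le_of_mul_le_mul_right this habs]
    -- The defect at the fixed coordinate `i` is at most the total defect, which vanishes as `j →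
    -- ∞`; dividing by `|x m i|` keeps this limit.
    · have hlow : ∀ j, 1 - (1 - φ.symm (x m) (y j)) / |x m i| ≤
          σ * φ.symm (stdBasis i) (y j) := by
        intro j
        have h := defect_le φ (x m) (hy1 j) i
        rw [hdef] at h
        have : 1 - σ * φ.symm (stdBasis i) (y j) ≤ (1 - φ.symm (x m) (y j)) / |x m i| := by
          rw [le_div_iff₀ habs]
          linarith [hx m]
        linarith
      have hup : ∀ j, σ * φ.symm (stdBasis i) (y j) ≤ 1 := by
        intro j
        have h := defect_nonneg φ (x m) (hy1 j) i
        rw [hdef] at h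
        linarith [nonneg_of_mul_nonneg_right h habs]
      refine tendsto_of_tendsto_of_tendsto_of_le_of_le ?_ tendsto_const_nhds hlow hup
      simpa using ((hxy m).const_sub 1).div_const |x m i| |>.const_sub 1
  obtain ⟨n, hn, hP⟩ := extraction_forall_of_frequently hfreq
  choose σ hσ hσ1 hσ2 using hP
  obtain ⟨e, s, hs, hse⟩ := exists_subseq_tendsto_weakStar φ (g := fun k => stdBasis (n k))
    (fun k => (norm_stdBasis _).le)
  -- A further subsequence makes the sign constant, so one sign `τ` serves for the limit too.
  obtain ⟨τ, hτ, hfτ⟩ : ∃ τ : ℝ, |τ| = 1 ∧ ∃ᶠ k in atTop, σ (s k) = τ := by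
    have : ∃ᶠ k in atTop, (σ (s k) = 1 ∨ σ (s k) = -1) :=
      (Eventually.of_forall fun k => hσ (s k)).frequently
    rcases frequently_or_distrib.1 this with h | h
    · exact ⟨1, by simp, h⟩
    · exact ⟨-1, by simp, h⟩
  obtain ⟨t, ht, htτ⟩ := extraction_of_frequently_atTop hfτ
  have hst : StrictMono fun k => s (t k) := hs.comp ht
  have hlim : ∀ w : X, Tendsto (fun k => φ.symm (stdBasis (n (s (t k)))) w) atTop
      (𝓝 (φ.symm e w)) := fun w => (hse w).comp ht.tendsto_atTop
  have he1 : ‖e‖ ≤ 1 := norm_le_one_of_tendsto φ (fun k => (norm_stdBasis _).le) hlim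
  have hlow : ∀ j, 1 - (1 / 2 : ℝ) ^ j ≤ φ.symm (τ • e) (y j) := by
    intro j
    have h1 : Tendsto (fun k => τ * φ.symm (stdBasis (n (s (t k)))) (y j)) atTop
        (𝓝 (τ * φ.symm e (y j))) := (hlim (y j)).const_mul τ
    have h2 : ∀ᶠ k in atTop, 1 - (1 / 2 : ℝ) ^ j ≤
        τ * φ.symm (stdBasis (n (s (t k)))) (y j) := by
      filter_upwards [eventually_ge_atTop j] with k hk
      rw [← htτ k]
      exact hσ1 _ j (hk.trans (hst.id_le k))
    simpa using ge_of_tendsto h1 h2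
  have hpow : Tendsto (fun j : ℕ => (1 / 2 : ℝ) ^ j) atTop (𝓝 0) :=
    tendsto_pow_atTop_nhds_zero_of_lt_one (by norm_num) (by norm_num)
  have hτe : ‖τ • e‖ = ‖e‖ := by rw [norm_smul, Real.norm_eq_abs, hτ, one_mul]
  refine ⟨fun k => n (s (t k)), hn.comp hst, e, le_antisymm he1 ?_,
    (tendsto_weakStar_iff φ).2 hlim, fun k => ?_⟩
  · have h1 : ∀ j, 1 - (1 / 2 : ℝ) ^ j ≤ ‖e‖ := fun j =>
      (hlow j).trans <| (dual_apply_le φ _ _).trans <| by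
        rw [hτe]; exact mul_le_of_le_one_right (norm_nonneg _) (hy1 j)
    exact le_of_tendsto (by simpa using hpow.const_sub 1) (Eventually.of_forall h1)
  -- Both `τ • e` and `τ • stdBasis i` are asymptotically normed by the same `y j`, so the signs
  -- agree: in the limit the defect at `i` gives `|e i| ≤ e i`.
  · set i := n (s (t k)) with hi
    have h1 : ∀ j, |e i| - e i * (τ * φ.symm (stdBasis i) (y j)) ≤ (1 / 2) ^ j := by
      intro j
      have h := defect_le φ (τ • e) (hy1 j) i
      have h' := hlow j
      rw [hτe] at h
      have h3 : |(τ • e) i| = |e i| := by simp [abs_mul, hτ]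
      have h4 : (τ • e) i = τ * e i := by simp
      rw [h3, h4] at h
      linarith
    have h2 : Tendsto (fun j => |e i| - e i * (τ * φ.symm (stdBasis i) (y j))) atTop
        (𝓝 (|e i| - e i * 1)) := by
      have := hσ2 (s (t k))
      rw [htτ k] at this
      exact (this.const_mul (e i)).const_sub _
    have h3 := le_of_tendsto_of_tendsto' h2 hpow h1
    linarith [abs_nonneg (e i)]

end

section

/-! ### Nonexpansive maps without fixed points -/

/-- A self-map of a compact convex set has a minimal nonempty closed convex invariant set. -/
theorem exists_minimal_invariant {E : Type*} [AddCommGroup E] [Module ℝ E] [TopologicalSpace E]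
    [T2Space E] {C : Set E} (hC : IsCompact C) (hne : C.Nonempty) (hconv : Convex ℝ C) {T : E → E}
    (hT : Set.MapsTo T C C) :
    ∃ K ⊆ C, K.Nonempty ∧ Convex ℝ K ∧ IsClosed K ∧ Set.MapsTo T K K ∧
      ∀ L ⊆ K, L.Nonempty → Convex ℝ L → IsClosed L → Set.MapsTo T L L → L = K := by
  obtain ⟨K, hK⟩ := zorn_superset
    {K : Set E | K ⊆ C ∧ K.Nonempty ∧ Convex ℝ K ∧ IsClosed K ∧ Set.MapsTo T K K} (by
      intro c hc hchain
      rcases c.eq_empty_or_nonempty with rfl | hcne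
      · exact ⟨C, ⟨subset_rfl, hne, hconv, hC.isClosed, hT⟩, by simp⟩
      refine ⟨⋂₀ c, ⟨?_, ?_, ?_, ?_, ?_⟩, fun s hs => Set.sInter_subset_of_mem hs⟩
      · obtain ⟨s, hs⟩ := hcne
        exact (Set.sInter_subset_of_mem hs).trans (hc hs).1
      · have := hcne.to_subtype
        refine IsCompact.nonempty_sInter_of_directed_nonempty_isCompact_isClosed
          (fun s hs t ht => ?_) (fun s hs => (hc hs).2.1)
          (fun s hs => hC.of_isClosed_subset (hc hs).2.2.2.1 (hc hs).1)
          (fun s hs => (hc hs).2.2.2.1)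
        rcases hchain.total hs ht with h | h
        · exact ⟨s, hs, subset_rfl, h⟩
        · exact ⟨t, ht, h, subset_rfl⟩
      · exact convex_sInter fun s hs => (hc hs).2.2.1
      · exact isClosed_sInter fun s hs => (hc hs).2.2.2.1
      · exact fun x hx s hs => (hc hs).2.2.2.2 (hx s hs))
  obtain ⟨hKC, hKne, hKconv, hKcl, hKT⟩ := hK.prop
  refine ⟨K, hKC, hKne, hKconv, hKcl, hKT, fun L hLK h1 h2 h3 h4 => ?_⟩
  exact hLK.antisymm (hK.le_of_le ⟨hLK.trans hKC, h1, h2, h3, h4⟩ hLK)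

/-- A nonexpansive self-map of a bounded complete convex set has approximate fixed points. -/
theorem exists_approx_fixedPoint {E : Type*} [NormedAddCommGroup E] [NormedSpace ℝ E] {K : Set E}
    (hK : IsComplete K) (hne : K.Nonempty) (hconv : Convex ℝ K) (hb : Bornology.IsBounded K)
    {T : E → E} (hT : Set.MapsTo T K K) (hTn : ∀ x ∈ K, ∀ y ∈ K, ‖T x - T y‖ ≤ ‖x - y‖)
    {ε : ℝ} (hε : 0 < ε) : ∃ x ∈ K, ‖T x - x‖ ≤ ε := by
  obtain ⟨p, hp⟩ := hne
  obtain ⟨R, hR⟩ := hb.exists_norm_le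
  have hR0 : 0 ≤ R := (norm_nonneg p).trans (hR p hp)
  -- The fixed point of the contraction `δ p + (1 - δ) T` is displaced by `T` by `δ ‖T x - p‖ ≤ 2 R
  -- δ`. The `+ 1` keeps the denominator positive when `R = 0`.
  set δ : ℝ := min (1 / 2) (ε / (2 * R + 1)) with hδ
  have hδ0 : 0 < δ := lt_min (by norm_num) (by positivity)
  have hδ1 : δ ≤ 1 / 2 := min_le_left _ _
  have hδ2 : δ * (2 * R + 1) ≤ ε := by
    rw [← le_div_iff₀ (by positivity)]; exact min_le_right _ _
  let S : E → E := fun x => δ • p + (1 - δ) • T x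
  have hS : Set.MapsTo S K K := fun x hx =>
    hconv hp (hT hx) hδ0.le (by linarith) (by ring)
  have hcontr : ContractingWith (Real.toNNReal (1 - δ)) (hS.restrict S K K) := by
    refine ⟨?_, LipschitzWith.of_dist_le_mul fun x y => ?_⟩
    · rw [Real.toNNReal_lt_one]; linarith
    · rw [Real.coe_toNNReal _ (by linarith), Subtype.dist_eq, Subtype.dist_eq]
      simp only [Set.MapsTo.val_restrict_apply, dist_eq_norm, S]
      rw [add_sub_add_left_eq_sub, ← smul_sub, norm_smul, Real.norm_of_nonneg (by linarith)]
      exact mul_le_mul_of_nonneg_left (hTn _ x.2 _ y.2) (by linarith)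
  obtain ⟨x, hx, hfix, -⟩ := hcontr.exists_fixedPoint' hK hS hp (edist_ne_top _ _)
  refine ⟨x, hx, ?_⟩
  have h1 : T x - x = δ • (T x - p) := by
    have h : δ • p + (1 - δ) • T x = x := hfix
    nth_rewrite 2 [← h]
    module
  rw [h1, norm_smul, Real.norm_of_nonneg hδ0.le]
  have h2 : ‖T x - p‖ ≤ 2 * R + 1 := by
    have := norm_sub_le (T x) p
    linarith [hR _ (hT hx), hR _ hp]
  exact (mul_le_mul_of_nonneg_left h2 hδ0.le).trans hδ2

/-- By Tychonoff on a cube; boundedness puts the pointwise limit in `ℓ₁`. This limit is unrelated to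
the weak* topology and may lie outside the set containing the sequence. -/
theorem exists_subseq_tendsto_coord {x : ℕ → Ell1} {R : ℝ} (hx : ∀ n, ‖x n‖ ≤ R) :
    ∃ (y : Ell1) (s : ℕ → ℕ), StrictMono s ∧
      ∀ i, Tendsto (fun n => x (s n) i) atTop (𝓝 (y i)) := by
  have hc : IsCompact (Set.pi Set.univ fun _ : ℕ => Set.Icc (-R) R) :=
    isCompact_univ_pi fun _ => isCompact_Icc
  obtain ⟨a, -, s, hs, ha⟩ := hc.tendsto_subseq (x := fun n => (x n : ℕ → ℝ))
    (fun n i _ => abs_le.1 ((abs_apply_le (x n) i).trans (hx n)))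
  have hb : Bornology.IsBounded (Set.range fun n => x (s n)) :=
    isBounded_iff_forall_norm_le.2 ⟨R, by rintro _ ⟨n, rfl⟩; exact hx _⟩
  exact ⟨⟨a, lp.memℓp_of_tendsto hb ha⟩, s, hs, fun i => tendsto_pi_nhds.1 ha i⟩

/-- If `u n → 0` coordinatewise in `ℓ₁`, then `‖u n - v‖ - ‖u n‖ → ‖v‖`. -/
theorem tendsto_norm_sub_sub_norm {u : ℕ → Ell1} (hu : ∀ i, Tendsto (fun n => u n i) atTop (𝓝 0))
    (v : Ell1) : Tendsto (fun n => ‖u n - v‖ - ‖u n‖) atTop (𝓝 ‖v‖) := by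
  have h : ∀ n, ‖u n - v‖ - ‖u n‖ = ∑' i, (|u n i - v i| - |u n i|) := fun n =>
    ((hasSum_abs (u n - v)).sub (hasSum_abs (u n))).tsum_eq.symm
  simp_rw [h, ← (hasSum_abs v).tsum_eq]
  refine tendsto_tsum_of_dominated_convergence (summable_abs v) (fun i => ?_)
    (Eventually.of_forall fun n i => ?_)
  · simpa using ((hu i).sub_const (v i)).abs.sub (hu i).abs
  · rw [Real.norm_eq_abs]
    simpa using abs_abs_sub_abs_le (u n i - v i) (u n i)

variable (φ : StrongDual ℝ X ≃ₗᵢ[ℝ] Ell1)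

theorem isBounded_of_isCompact_toWeak [CompleteSpace X] {C : Set Ell1}
    (hC : IsCompact (toWeak φ '' C)) : ∃ R, ∀ x ∈ C, ‖x‖ ≤ R := by
  obtain ⟨R, hR⟩ := banach_steinhaus (g := fun x : C => φ.symm (x : Ell1)) fun z => by
    obtain ⟨R, hR⟩ := (hC.image (WeakDual.eval_continuous z)).isBounded.exists_norm_le
    exact ⟨R, fun x => hR _ ⟨_, ⟨x, x.2, rfl⟩, rfl⟩⟩
  exact ⟨R, fun x hx => by simpa using hR ⟨x, hx⟩⟩

/-- A weak* compact convex set outside the open unit ball is almost normed by a single vector. -/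
theorem exists_almost_norming {K : Set Ell1} (hK : IsCompact (toWeak φ '' K)) (hconv : Convex ℝ K)
    (hne : K.Nonempty) (h1 : ∀ x ∈ K, 1 ≤ ‖x‖) {ε : ℝ} (hε : 0 < ε) (hε1 : ε ≤ 1) :
    ∃ z : X, ‖z‖ ≤ 1 ∧ ∀ x ∈ K, 1 - ε ≤ φ.symm x z := by
  have : LocallyConvexSpace ℝ (WeakDual ℝ X) := (WeakDual.withSeminorms ℝ X).toLocallyConvexSpace
  -- The ball of radius `1 - ε` is weak* compact and misses `K`; the separating functional is
  -- evaluation at some `z : X`, with supremum `(1 - ε) ‖z‖` over the ball.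
  obtain ⟨f, u, v, hu, huv, hv⟩ := geometric_hahn_banach_compact_closed
    (s := toWeak φ '' Metric.closedBall 0 (1 - ε)) (t := toWeak φ '' K)
    ((convex_closedBall _ _).linear_image (toWeak φ).toLinearMap)
    (isCompact_toWeak_closedBall φ 0 (1 - ε)) (hconv.linear_image (toWeak φ).toLinearMap)
    hK.isClosed (by
      rw [Set.disjoint_image_iff (toWeak φ).injective, Set.disjoint_left]
      intro x hx hxK
      have := h1 x hxK
      rw [mem_closedBall_zero_iff] at hx
      linarith)
  obtain ⟨z, hz⟩ := exists_eval_eq f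
  have hu' : ∀ x : Ell1, ‖x‖ ≤ 1 - ε → φ.symm x z < u := fun x hx => by
    have := hu _ ⟨x, by simpa using hx, rfl⟩
    rwa [hz] at this
  have hv' : ∀ x ∈ K, u < φ.symm x z := fun x hx => by
    have := hv _ ⟨x, hx, rfl⟩
    rw [hz] at this
    exact huv.trans this
  have hu0 : 0 < u := by simpa using hu' 0 (by simpa using hε1)
  have hzu : (1 - ε) * ‖z‖ ≤ u := by
    obtain ⟨g, hg1, hgz⟩ := exists_dual_vector'' ℝ z
    have := hu' (φ ((1 - ε) • g)) (by
      rw [φ.norm_map, norm_smul, Real.norm_of_nonneg (by linarith)]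
      exact mul_le_of_le_one_right (by linarith) hg1)
    simp [hgz] at this
    exact this.le
  have hz0 : 0 < ‖z‖ := by
    obtain ⟨x, hx⟩ := hne
    rw [norm_pos_iff]
    rintro rfl
    have := hv' x hx
    simp at this
    linarith
  refine ⟨‖z‖⁻¹ • z, by rw [norm_smul, norm_inv, norm_norm, inv_mul_cancel₀ hz0.ne'],
    fun x hx => ?_⟩
  rw [map_smul, smul_eq_mul, inv_mul_eq_div, le_div_iff₀ hz0]
  exact hzu.trans (hv' x hx).le

theorem hasNormOneLimit_of_not_hasFPP_nonexpansive [CompleteSpace X]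
    (h : ¬ HasFPP φ Nonexpansive) : HasNormOneLimit φ := by
  classical
  unfold HasFPP at h
  push Not at h
  obtain ⟨C, hne, hconv, hcomp, T₀, hT₀, hfix⟩ := h
  rw [isCompact_weakStar_iff] at hcomp
  -- The values outside `C` play no role.
  let T : Ell1 → Ell1 := fun x => if hx : x ∈ C then T₀ ⟨x, hx⟩ else x
  have hTC : ∀ x (hx : x ∈ C), T x = T₀ ⟨x, hx⟩ := fun x hx => dif_pos hx
  have hTmaps : ∀ x ∈ C, T x ∈ C := fun x hx => by rw [hTC x hx]; exact (T₀ _).2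
  have hTn : ∀ x ∈ C, ∀ y ∈ C, ‖T x - T y‖ ≤ ‖x - y‖ := fun x hx y hy => by
    rw [hTC x hx, hTC y hy]; exact hT₀ ⟨x, hx⟩ ⟨y, hy⟩
  have hTfix : ∀ x ∈ C, T x ≠ x := fun x hx hTx =>
    hfix ⟨x, hx⟩ (Subtype.ext (by rw [← hTC x hx, hTx]))
  let Φ := toWeak φ
  obtain ⟨K', hK'C, hK'ne, hK'conv, hK'cl, hK'T, hmin⟩ := exists_minimal_invariant hcomp
    (hne.image _) (hconv.linear_image Φ.toLinearMap) (T := fun g => Φ (T (Φ.symm g))) (by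
      rintro _ ⟨x, hx, rfl⟩
      exact ⟨T x, hTmaps x hx, by simp [Φ]⟩)
  set K : Set Ell1 := Φ ⁻¹' K' with hKdef
  have hΦK : Φ '' K = K' := Set.image_preimage_eq _ Φ.surjective
  have hKC : K ⊆ C := fun x hx => by
    obtain ⟨y, hy, hxy⟩ := hK'C hx
    rwa [← Φ.injective hxy]
  have hKne : K.Nonempty := hK'ne.preimage Φ.surjective
  have hKconv : Convex ℝ K := hK'conv.linear_preimage Φ.toLinearMap
  have hKcl : IsClosed K := hK'cl.preimage (continuous_toWeak φ)
  have hKcomp : IsCompact (Φ '' K) := hΦK ▸ hcomp.of_isClosed_subset hK'cl hK'C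
  have hKT : Set.MapsTo T K K := fun x hx => by
    simpa [hKdef, Φ] using hK'T (x := Φ x) hx
  obtain ⟨R, hR⟩ := isBounded_of_isCompact_toWeak φ hKcomp
  have hap : ∀ n : ℕ, ∃ x ∈ K, ‖T x - x‖ ≤ 1 / ((n : ℝ) + 1) := fun n =>
    exists_approx_fixedPoint hKcl.isComplete hKne hKconv
      (isBounded_iff_forall_norm_le.2 ⟨R, hR⟩) hKT
      (fun x hx y hy => hTn x (hKC hx) y (hKC hy)) Nat.one_div_pos_of_nat
  choose x hxK hxT using hap
  obtain ⟨y, s, hs, hsy⟩ := exists_subseq_tendsto_coord fun n => hR _ (hxK n)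
  have hu0 : ∀ i, Tendsto (fun n => (x (s n) - y) i) atTop (𝓝 0) := fun i => by
    simpa using (hsy i).sub_const (y i)
  have hxT0 : Tendsto (fun n => ‖T (x (s n)) - x (s n)‖) atTop (𝓝 0) :=
    squeeze_zero (fun _ => norm_nonneg _) (fun n => hxT (s n))
      (tendsto_one_div_add_atTop_nhds_zero_nat.comp hs.tendsto_atTop)
  -- Compare the distances from `x (s n)` to `T w` and to `w`. Since `x (s n)` is almost fixed, the
  -- first exceeds the second by at most an error tending to zero; subtracting `‖x (s n) - y‖` from
  -- both leaves the distances to `y` in the limit.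
  have hdist : ∀ w ∈ K, ‖T w - y‖ ≤ ‖w - y‖ := by
    intro w hw
    have h1 := tendsto_norm_sub_sub_norm hu0 (T w - y)
    have h2 := (tendsto_norm_sub_sub_norm hu0 (w - y)).add hxT0
    simp only [sub_sub_sub_cancel_right, add_zero] at h1 h2
    refine le_of_tendsto_of_tendsto' h1 h2 fun n => ?_
    have h3 : ‖x (s n) - T w‖ ≤ ‖x (s n) - T (x (s n))‖ + ‖T (x (s n)) - T w‖ :=
      norm_sub_le_norm_sub_add_norm_sub _ _ _
    have h4 := hTn _ (hKC (hxK (s n))) w (hKC hw)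
    rw [norm_sub_rev (x (s n)) (T (x (s n)))] at h3
    linarith
  -- The part of `K` in the ball about `y` through `w` is again weak* closed, convex and invariant,
  -- so by minimality it is all of `K`.
  have hle : ∀ w ∈ K, ∀ w' ∈ K, ‖w' - y‖ ≤ ‖w - y‖ := by
    intro w hw w' hw'
    have hL := hmin (Φ '' (K ∩ Metric.closedBall y ‖w - y‖)) ?_ ?_ ?_ ?_ ?_
    · have : Φ w' ∈ Φ '' (K ∩ Metric.closedBall y ‖w - y‖) := by rw [hL]; exact hw'
      rw [Φ.injective.mem_set_image] at this
      simpa [dist_eq_norm] using this.2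
    · rw [← hΦK]; exact Set.image_mono Set.inter_subset_left
    · exact ⟨Φ w, w, ⟨hw, by simp [dist_eq_norm]⟩, rfl⟩
    · exact (hKconv.inter (convex_closedBall _ _)).linear_image Φ.toLinearMap
    · rw [Set.image_inter Φ.injective, hΦK]
      exact hK'cl.inter (isCompact_toWeak_closedBall φ y _).isClosed
    · rintro _ ⟨p, ⟨hpK, hpb⟩, rfl⟩
      refine ⟨T p, ⟨hKT hpK, ?_⟩, by simp⟩
      rw [Metric.mem_closedBall, dist_eq_norm] at hpb ⊢
      exact (hdist p hpK).trans hpb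
  obtain ⟨p, hp⟩ := hKne
  set ρ := ‖p - y‖ with hρ
  have hconst : ∀ w ∈ K, ‖w - y‖ = ρ := fun w hw => le_antisymm (hle p hp w hw) (hle w hw p hp)
  -- Radius zero would reduce `K` to the point `y`, which would be fixed.
  have hρ0 : 0 < ρ := by
    refine (norm_nonneg _).lt_of_ne fun h0 => hTfix p (hKC hp) ?_
    have h2 := hconst (T p) (hKT hp)
    rw [hρ, ← h0, norm_eq_zero, sub_eq_zero] at h2
    rw [h2, ← sub_eq_zero, ← norm_eq_zero, norm_sub_rev, h0]
  let A : Ell1 → Ell1 := fun w => ρ⁻¹ • (w - y)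
  have hA : ∀ w ∈ K, ‖A w‖ = 1 := fun w hw => by
    simp only [A]
    rw [norm_smul, hconst w hw, norm_inv, Real.norm_of_nonneg hρ0.le, inv_mul_cancel₀ hρ0.ne']
  have hAconv : Convex ℝ (A '' K) := by
    have := (hKconv.translate (-y)).smul ρ⁻¹
    rw [← Set.image_smul, Set.image_image] at this
    simpa only [A, neg_add_eq_sub] using this
  have hAcomp : IsCompact (Φ '' (A '' K)) := by
    have h1 : Continuous fun g : WeakDual ℝ X => ρ⁻¹ • (g - Φ y) := by fun_prop
    have h2 := hKcomp.image h1
    rw [Set.image_image] at h2 ⊢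
    simpa [A] using h2
  have hz : ∀ j : ℕ, ∃ z : X, ‖z‖ ≤ 1 ∧ ∀ w ∈ A '' K, 1 - 1 / ((j : ℝ) + 1) ≤ φ.symm w z :=
    fun j => exists_almost_norming φ hAcomp hAconv (Set.Nonempty.image A ⟨p, hp⟩)
      (by rintro _ ⟨w, hw, rfl⟩; exact (hA w hw).ge) Nat.one_div_pos_of_nat
      (by rw [div_le_one (by positivity)]; linarith [(Nat.cast_nonneg j : (0 : ℝ) ≤ j)])
  choose z hz1 hzK using hz
  have hlim : Tendsto (fun j : ℕ => 1 - 1 / ((j : ℝ) + 1)) atTop (𝓝 1) := by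
    simpa using tendsto_one_div_add_atTop_nhds_zero_nat (𝕜 := ℝ) |>.const_sub 1
  refine hasNormOneLimit_of_norming φ (x := fun m => A (x (s m))) (fun m => (hA _ (hxK _)).le)
    (fun i => ?_) hz1 (fun m => ?_) hlim (fun j => ?_)
  · have h := (hu0 i).const_mul ρ⁻¹
    rwa [mul_zero] at h
  · refine tendsto_of_tendsto_of_tendsto_of_le_of_le hlim tendsto_const_nhds
      (fun j => hzK j _ ⟨_, hxK _, rfl⟩) fun j => ?_
    refine (dual_apply_le φ _ _).trans ?_
    rw [hA _ (hxK _), one_mul]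
    exact hz1 j
  · exact Eventually.of_forall fun m => hzK j _ ⟨_, hxK _, rfl⟩

end

/-! ### Weak* convergent copies of `ℓ₁` and fixed point free maps -/

section

/-- The sequence with first term `a`, followed by the terms of `f`. -/
def consSeq {α : Type*} (a : α) (f : ℕ → α) : ℕ → α
  | 0 => a
  | n + 1 => f n

/-- The element of `ℓ₁` with first coordinate `a`, followed by the coordinates of `b`. -/
def cons (a : ℝ) (b : Ell1) : Ell1 :=
  ofSummable (consSeq a b) ((summable_nat_add_iff 1).1 (summable_abs b))

theorem cons_zero (a : ℝ) (b : Ell1) : cons a b 0 = a := rfl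

theorem cons_succ (a : ℝ) (b : Ell1) (n : ℕ) : cons a b (n + 1) = b n := rfl

theorem norm_cons (a : ℝ) (b : Ell1) : ‖cons a b‖ = |a| + ‖b‖ := by
  rw [← (hasSum_abs _).tsum_eq, ← (hasSum_abs b).tsum_eq, (summable_abs _).tsum_eq_zero_add]
  simp only [cons_zero, cons_succ]

theorem tsum_cons (a : ℝ) (b : Ell1) : ∑' n, cons a b n = a + ∑' n, b n := by
  rw [(summable_coord _).tsum_eq_zero_add]
  simp only [cons_zero, cons_succ]

/-! ### Isometric copies of `ℓ₁` spanned by disjoint elements -/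

theorem summable_smul_of_norm_eq_one {d : ℕ → Ell1} (hd : ∀ k, ‖d k‖ = 1) (b : Ell1) :
    Summable fun k => b k • d k :=
  Summable.of_norm (by simpa [norm_smul, hd] using summable_abs b)

theorem hasSum_smul_coord {d : ℕ → Ell1} (hd : ∀ k, ‖d k‖ = 1) (b : Ell1) (i : ℕ) :
    HasSum (fun k => b k * d k i) ((∑' k, b k • d k) i) := by
  have h := (summable_smul_of_norm_eq_one hd b).hasSum.mapL
    (lp.evalCLM ℝ (fun _ : ℕ => ℝ) (p := 1) i)
  exact h

theorem norm_tsum_smul_of_disjoint {d : ℕ → Ell1} (hd : ∀ k, ‖d k‖ = 1)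
    (hdisj : ∀ j k, j ≠ k → ∀ i, d j i = 0 ∨ d k i = 0) (b : Ell1) :
    ‖∑' k, b k • d k‖ = ‖b‖ := by
  have habs : ∀ i, |(∑' k, b k • d k) i| = ∑' k, |b k| * |d k i| := by
    intro i
    rw [← (hasSum_smul_coord hd b i).tsum_eq]
    by_cases h : ∃ k, d k i ≠ 0
    · obtain ⟨k, hk⟩ := h
      have h0 : ∀ j, j ≠ k → d j i = 0 := fun j hj => (hdisj j k hj i).resolve_right hk
      rw [tsum_eq_single k fun j hj => by rw [h0 j hj, mul_zero],
        tsum_eq_single k fun j hj => by rw [h0 j hj, abs_zero, mul_zero], abs_mul]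
    · push Not at h
      simp [h]
  have hsum : Summable (Function.uncurry fun k i => |b k| * |d k i|) := by
    refine (summable_prod_of_nonneg fun p =>
      mul_nonneg (abs_nonneg _) (abs_nonneg _)).2 ⟨fun k => ?_, ?_⟩
    · exact (summable_abs (d k)).mul_left |b k|
    · simpa [tsum_mul_left, (hasSum_abs _).tsum_eq, hd] using summable_abs b
  rw [← (hasSum_abs _).tsum_eq, tsum_congr habs, hsum.tsum_comm, ← (hasSum_abs b).tsum_eq]
  exact tsum_congr fun k => by rw [tsum_mul_left, (hasSum_abs _).tsum_eq, hd, mul_one]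

/-- The isometry of `ℓ₁` into itself sending the standard basis to a sequence of disjoint elements
of norm one. -/
def disjointIsometry (d : ℕ → Ell1) (hd : ∀ k, ‖d k‖ = 1)
    (hdisj : ∀ j k, j ≠ k → ∀ i, d j i = 0 ∨ d k i = 0) : Ell1 →ₗᵢ[ℝ] Ell1 where
  toFun b := ∑' k, b k • d k
  map_add' b b' := by
    rw [← (summable_smul_of_norm_eq_one hd b).tsum_add (summable_smul_of_norm_eq_one hd b')]
    exact tsum_congr fun k => by simp [add_smul]
  map_smul' r b := by
    rw [RingHom.id_apply, ← tsum_const_smul'']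
    exact tsum_congr fun k => by simp [mul_smul]
  norm_map' := norm_tsum_smul_of_disjoint hd hdisj

theorem disjointIsometry_stdBasis {d : ℕ → Ell1} (hd : ∀ k, ‖d k‖ = 1)
    (hdisj : ∀ j k, j ≠ k → ∀ i, d j i = 0 ∨ d k i = 0) (k : ℕ) :
    disjointIsometry d hd hdisj (stdBasis k) = d k := by
  change ∑' j, stdBasis k j • d j = d k
  rw [tsum_eq_single k fun j hj => by simp [stdBasis_apply, hj]]
  simp [stdBasis_apply]

theorem disjointIsometry_coord {d : ℕ → Ell1} (hd : ∀ k, ‖d k‖ = 1)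
    (hdisj : ∀ j k, j ≠ k → ∀ i, d j i = 0 ∨ d k i = 0) (b : Ell1) {i k : ℕ} (hk : d k i ≠ 0) :
    disjointIsometry d hd hdisj b i = b k * d k i := by
  change (∑' j, b j • d j) i = _
  rw [← (hasSum_smul_coord hd b i).tsum_eq]
  exact tsum_eq_single k fun j hj => by rw [(hdisj j k hj i).resolve_right hk, mul_zero]

theorem disjointIsometry_coord_eq_zero {d : ℕ → Ell1} (hd : ∀ k, ‖d k‖ = 1)
    (hdisj : ∀ j k, j ≠ k → ∀ i, d j i = 0 ∨ d k i = 0) (b : Ell1) {i : ℕ} (h : ∀ k, d k i = 0) :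
    disjointIsometry d hd hdisj b i = 0 := by
  change (∑' j, b j • d j) i = _
  rw [← (hasSum_smul_coord hd b i).tsum_eq]
  simp [h]

/-- The set of nonnegative elements of `ℓ₁` with sum one. -/
def simplex : Set Ell1 := {b | (∀ i, 0 ≤ b i) ∧ ∑' i, b i = 1}

theorem mem_simplex_of_norm {c : Ell1} (h0 : ∀ i, 0 ≤ c i) (h1 : ‖c‖ = 1) : c ∈ simplex :=
  ⟨h0, by
    rw [← h1, ← (hasSum_abs c).tsum_eq]
    exact tsum_congr fun i => (abs_of_nonneg (h0 i)).symm⟩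

variable (φ : StrongDual ℝ X ≃ₗᵢ[ℝ] Ell1)

/-- An isometric copy of `ℓ₁` in itself whose basis converges weak* to a point of its simplex. -/
def IsWeakStarCopy (D : Ell1 →ₗᵢ[ℝ] Ell1) (c : Ell1) : Prop :=
  c ∈ simplex ∧ ∀ z : X, Tendsto (fun k => φ.symm (D (stdBasis k)) z) atTop (𝓝 (φ.symm (D c) z))

/-- The part `u` of `e` off the subsequence may have any signs; its normalisation becomes the first
vector of the copy, followed by the basis vectors. Then `e = D c` with `c = (‖u‖, e (n 0), e (n 1),
...)`, nonnegative and of norm `‖e‖ = 1`. -/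
theorem exists_isWeakStarCopy (h : HasNormOneLimit φ) : ∃ D c, IsWeakStarCopy φ D c := by
  classical
  obtain ⟨n₀, hn₀, e, he, hlim₀, hpos₀⟩ := h
  rw [tendsto_weakStar_iff] at hlim₀
  obtain ⟨i₀, hi₀⟩ : ∃ i, e i ≠ 0 := by
    by_contra! h0
    have : e = 0 := lp.ext (funext h0)
    simp [this] at he
  -- Dropping the first `i₀ + 1` indices leaves `i₀` outside the range, which ensures `u ≠ 0`.
  set n : ℕ → ℕ := fun k => n₀ (k + (i₀ + 1)) with hn
  have hinj : Function.Injective n := fun a b hab => by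
    have := hn₀.injective hab
    omega
  have hi₀n : i₀ ∉ Set.range n := by
    rintro ⟨k, hk⟩
    have := hn₀.id_le (k + (i₀ + 1))
    simp only [hn, id] at this hk
    omega
  have hlim : ∀ z : X, Tendsto (fun k => φ.symm (stdBasis (n k)) z) atTop (𝓝 (φ.symm e z)) :=
    fun z => (hlim₀ z).comp (tendsto_add_atTop_nat (i₀ + 1))
  let u : Ell1 := ofSummable (fun i => if i ∈ Set.range n then 0 else e i)
    ((summable_abs e).of_nonneg_of_le (fun _ => abs_nonneg _) fun i => by
      split_ifs <;> simp)
  have hu : ∀ i, u i = if i ∈ Set.range n then 0 else e i := fun i => rfl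
  have hu0 : ‖u‖ ≠ 0 := by
    intro h0
    rw [norm_eq_zero] at h0
    have : u i₀ = 0 := by rw [h0]; rfl
    rw [hu, if_neg hi₀n] at this
    exact hi₀ this
  let d : ℕ → Ell1 := consSeq (‖u‖⁻¹ • u) fun k => stdBasis (n k)
  have hdz : d 0 = ‖u‖⁻¹ • u := rfl
  have hds : ∀ k, d (k + 1) = stdBasis (n k) := fun k => rfl
  have hd : ∀ k, ‖d k‖ = 1 := by
    rintro (_ | k)
    · rw [hdz, norm_smul, norm_inv, norm_norm, inv_mul_cancel₀ hu0]
    · rw [hds, norm_stdBasis]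
  have h0s : ∀ k i, d 0 i = 0 ∨ d (k + 1) i = 0 := by
    intro k i
    by_cases hi : i = n k
    · left
      have : u i = 0 := by rw [hu, if_pos ⟨k, hi.symm⟩]
      simp [hdz, this]
    · right
      rw [hds, stdBasis_apply, if_neg hi]
  have hdisj : ∀ j k, j ≠ k → ∀ i, d j i = 0 ∨ d k i = 0 := by
    rintro (_ | j) (_ | k) hjk i
    · exact absurd rfl hjk
    · exact h0s k i
    · exact (h0s j i).symm
    · rw [hds, hds, stdBasis_apply, stdBasis_apply]
      by_cases hi : i = n j
      · right
        refine if_neg fun hi' => hjk ?_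
        rw [hinj (hi.symm.trans hi')]
      · exact Or.inl (if_neg hi)
  let c : Ell1 := cons ‖u‖ (ofSummable (fun k => e (n k)) ((summable_abs e).comp_injective hinj))
  set D := disjointIsometry d hd hdisj with hD
  have hDc : D c = e := by
    refine lp.ext (funext fun i => ?_)
    by_cases hi : i ∈ Set.range n
    · obtain ⟨k, rfl⟩ := hi
      have h1 : d (k + 1) (n k) = 1 := by rw [hds, stdBasis_apply, if_pos rfl]
      rw [hD, disjointIsometry_coord hd hdisj c (k := k + 1) (by rw [h1]; exact one_ne_zero), h1,
        mul_one]
      rfl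
    · have h1 : ∀ k, d (k + 1) i = 0 := fun k => by
        rw [hds, stdBasis_apply, if_neg fun h => hi ⟨k, h.symm⟩]
      have h2 : d 0 i = ‖u‖⁻¹ * e i := by
        have h3 : u i = e i := by rw [hu, if_neg hi]
        rw [hdz, ← h3]
        rfl
      by_cases hei : e i = 0
      · rw [hei]
        refine disjointIsometry_coord_eq_zero hd hdisj c fun k => ?_
        cases k with
        | zero => rw [h2, hei, mul_zero]
        | succ k => exact h1 k
      · rw [hD, disjointIsometry_coord hd hdisj c (k := 0)
          (by rw [h2]; exact mul_ne_zero (inv_ne_zero hu0) hei), h2]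
        change ‖u‖ * _ = _
        rw [mul_inv_cancel_left₀ hu0]
  refine ⟨D, c, mem_simplex_of_norm ?_ ?_, fun z => ?_⟩
  · rintro (_ | k)
    · exact norm_nonneg u
    · exact hpos₀ _
  · rw [← D.norm_map, hDc, he]
  · rw [hDc, ← tendsto_add_atTop_iff_nat 1]
    simp only [hD, disjointIsometry_stdBasis]
    exact hlim z

/-! ### Weak* compactness of the simplex of a weak* copy -/

theorem convex_simplex : Convex ℝ simplex := by
  rintro x ⟨hx0, hx1⟩ y ⟨hy0, hy1⟩ a b ha hb hab
  refine ⟨fun i => ?_, ?_⟩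
  · have : (a • x + b • y) i = a * x i + b * y i := rfl
    rw [this]
    exact add_nonneg (mul_nonneg ha (hx0 i)) (mul_nonneg hb (hy0 i))
  · have : ∀ i, (a • x + b • y) i = a * x i + b * y i := fun i => rfl
    rw [tsum_congr this, ((summable_coord x).mul_left a).tsum_add ((summable_coord y).mul_left b),
      tsum_mul_left, tsum_mul_left, hx1, hy1]
    linarith

/-- Nonnegative sequences with sum at most one. -/
def subsimplex : Set (ℕ → ℝ) := {t | (∀ i, 0 ≤ t i) ∧ ∀ N, ∑ i ∈ Finset.range N, t i ≤ 1}

theorem summable_of_mem_subsimplex {t : ℕ → ℝ} (ht : t ∈ subsimplex) : Summable t :=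
  summable_of_sum_range_le ht.1 ht.2

theorem tsum_le_one_of_mem_subsimplex {t : ℕ → ℝ} (ht : t ∈ subsimplex) : ∑' i, t i ≤ 1 :=
  Real.tsum_le_of_sum_range_le ht.1 ht.2

theorem isCompact_subsimplex : IsCompact subsimplex := by
  refine (isCompact_univ_pi fun _ : ℕ => isCompact_Icc (a := (0 : ℝ)) (b := 1)).of_isClosed_subset
    ?_ fun t ht i _ => ⟨ht.1 i, ?_⟩
  · have : subsimplex = (⋂ i, {t | 0 ≤ t i}) ∩ ⋂ N, {t | ∑ i ∈ Finset.range N, t i ≤ 1} := by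
      ext t; simp [subsimplex]
    rw [this]
    refine (isClosed_iInter fun i => isClosed_le continuous_const (continuous_apply i)).inter
      (isClosed_iInter fun N => isClosed_le ?_ continuous_const)
    exact continuous_finsetSum _ fun i _ => continuous_apply i
  · exact (Finset.single_le_sum (f := t) (fun j _ => ht.1 j) (Finset.self_mem_range_succ i)).trans
      (ht.2 (i + 1))

/-- The pairing with a null sequence is coordinatewise continuous on `subsimplex`. -/
theorem continuous_tsum_subsimplex {b : ℕ → ℝ} (hb : Tendsto b atTop (𝓝 0)) :
    Continuous fun t : subsimplex => ∑' k, (t : ℕ → ℝ) k * b k := by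
  obtain ⟨M, hM⟩ := (Metric.isBounded_range_of_tendsto b hb).exists_norm_le
  have hsum : ∀ t : subsimplex, Summable fun k => (t : ℕ → ℝ) k * b k := fun t =>
    Summable.of_norm_bounded ((summable_of_mem_subsimplex t.2).mul_right M) fun k => by
      rw [norm_mul, Real.norm_of_nonneg (t.2.1 k)]
      exact mul_le_mul_of_nonneg_left (hM _ ⟨k, rfl⟩) (t.2.1 k)
  have hunif : TendstoUniformly
      (fun N (t : subsimplex) => ∑ k ∈ Finset.range N, (t : ℕ → ℝ) k * b k)
      (fun t => ∑' k, (t : ℕ → ℝ) k * b k) atTop := by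
    rw [Metric.tendstoUniformly_iff]
    intro ε hε
    obtain ⟨N₀, hN₀⟩ := eventually_atTop.1
      (hb.norm.eventually (gt_mem_nhds (show ‖(0 : ℝ)‖ < ε / 2 by simpa using half_pos hε)))
    filter_upwards [eventually_ge_atTop N₀] with N hN t
    have hts := summable_of_mem_subsimplex t.2
    rw [dist_eq_norm, ← (hsum t).sum_add_tsum_nat_add N, add_sub_cancel_left]
    have h1 : ‖∑' k, (t : ℕ → ℝ) (k + N) * b (k + N)‖ ≤ ∑' k, (t : ℕ → ℝ) (k + N) * (ε / 2) := by
      refine tsum_of_norm_bounded (((summable_nat_add_iff N).2 hts).mul_right _).hasSum fun k => ?_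
      rw [norm_mul, Real.norm_of_nonneg (t.2.1 _)]
      exact mul_le_mul_of_nonneg_left (hN₀ _ (by omega)).le (t.2.1 _)
    have h2 : ∑' k, (t : ℕ → ℝ) (k + N) ≤ 1 := by
      have h3 := hts.sum_add_tsum_nat_add N
      have h4 := tsum_le_one_of_mem_subsimplex t.2
      have h5 : 0 ≤ ∑ k ∈ Finset.range N, (t : ℕ → ℝ) k := Finset.sum_nonneg fun k _ => t.2.1 k
      linarith
    rw [tsum_mul_right] at h1
    nlinarith
  refine hunif.continuous (Eventually.of_forall fun N => ?_).frequently
  exact continuous_finsetSum _ fun k _ =>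
    ((continuous_apply k).comp continuous_subtype_val).mul continuous_const

theorem hasSum_copy_apply (D : Ell1 →ₗᵢ[ℝ] Ell1) (h : Ell1) (z : X) :
    HasSum (fun n => h n * φ.symm (D (stdBasis n)) z) (φ.symm (D h) z) := by
  have hs := (hasSum_smul_stdBasis h).mapL
    ((ContinuousLinearMap.apply ℝ ℝ z).comp
      ((φ.symm.toContinuousLinearEquiv : Ell1 →L[ℝ] StrongDual ℝ X).comp D.toContinuousLinearMap))
  simpa using hs

/-- The compact set `subsimplex` is mapped onto the simplex by putting the missing mass `1 - ∑ t i`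
on `c`. Evaluated at `z`, this is a constant plus the pairing of `t` with the null sequence `D
(stdBasis k) z - D c z`, hence continuous. -/
theorem isCompact_toWeak_simplex {D : Ell1 →ₗᵢ[ℝ] Ell1} {c : Ell1} (h : IsWeakStarCopy φ D c) :
    IsCompact (toWeak φ '' (D '' simplex)) := by
  obtain ⟨⟨hc0, hc1⟩, hlim⟩ := h
  have habs : ∀ t : subsimplex, Summable fun i => |(t : ℕ → ℝ) i| := fun t =>
    (summable_of_mem_subsimplex t.2).abs
  let G : subsimplex → Ell1 := fun t =>
    ofSummable t (habs t) + (1 - ∑' i, (t : ℕ → ℝ) i) • c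
  have hG : ∀ t i, G t i = (t : ℕ → ℝ) i + (1 - ∑' i, (t : ℕ → ℝ) i) * c i := fun t i => rfl
  have himg : Set.range G = simplex := by
    apply Set.Subset.antisymm
    · rintro _ ⟨t, rfl⟩
      refine ⟨fun i => ?_, ?_⟩
      · rw [hG]
        exact add_nonneg (t.2.1 i) (mul_nonneg
          (sub_nonneg.2 (tsum_le_one_of_mem_subsimplex t.2)) (hc0 i))
      · rw [tsum_congr (hG t), (summable_of_mem_subsimplex t.2).tsum_add
          ((summable_coord c).mul_left _), tsum_mul_left, hc1]
        ring
    · rintro b ⟨hb0, hb1⟩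
      refine ⟨⟨b, hb0, fun N => ?_⟩, lp.ext (funext fun i => ?_)⟩
      · rw [← hb1]
        exact (summable_coord b).sum_le_tsum _ fun i _ => hb0 i
      · rw [hG]
        simp [hb1]
  have hcont : Continuous fun t => toWeak φ (D (G t)) := by
    refine WeakDual.continuous_of_continuous_eval fun z => ?_
    have heq : ∀ t : subsimplex, toWeak φ (D (G t)) z = φ.symm (D c) z +
        ∑' k, (t : ℕ → ℝ) k * (φ.symm (D (stdBasis k)) z - φ.symm (D c) z) := by
      intro t
      have hs := hasSum_copy_apply φ D (ofSummable t (habs t)) z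
      have hs2 := hs.sub ((summable_of_mem_subsimplex t.2).hasSum.mul_right (φ.symm (D c) z))
      change HasSum (fun k => (t : ℕ → ℝ) k * _ - (t : ℕ → ℝ) k * _) _ at hs2
      simp only [← mul_sub] at hs2
      rw [hs2.tsum_eq]
      have hD : φ.symm (D (G t)) = φ.symm (D (ofSummable t (habs t))) +
          (1 - ∑' i, (t : ℕ → ℝ) i) • φ.symm (D c) := by simp only [G, map_add, map_smul]
      rw [toWeak_apply, hD, add_apply, smul_apply, smul_eq_mul]
      ring
    simp_rw [heq]
    refine continuous_const.add (continuous_tsum_subsimplex ?_)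
    simpa using (hlim z).sub_const (φ.symm (D c) z)
  have : CompactSpace subsimplex := isCompact_iff_compactSpace.1 isCompact_subsimplex
  rw [← himg, ← Set.range_comp, ← Set.range_comp]
  exact isCompact_range hcont

/-! ### Fixed point free maps of the simplex -/

theorem not_hasFPP_of_map_simplex {D : Ell1 →ₗᵢ[ℝ] Ell1} {c : Ell1} (h : IsWeakStarCopy φ D c)
    {P : ∀ C : Set Ell1, (C → C) → Prop} {S : Ell1 → Ell1} (hS : Set.MapsTo S simplex simplex)
    (hfix : ∀ b ∈ simplex, S b ≠ b)
    (hP : ∀ T : D '' simplex → D '' simplex,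
      (∀ x : D '' simplex, ∃ b ∈ simplex, (x : Ell1) = D b ∧ (T x : Ell1) = D (S b)) →
        P (D '' simplex) T) :
    ¬ HasFPP φ P := by
  intro hF
  have hb : ∀ x : D '' simplex, ∃ b ∈ simplex, (x : Ell1) = D b := fun x => by
    obtain ⟨b, hb, hx⟩ := x.2
    exact ⟨b, hb, hx.symm⟩
  choose B hB hBx using hb
  obtain ⟨x, hx⟩ := hF (D '' simplex) ⟨_, c, h.1, rfl⟩
    (convex_simplex.linear_image D.toLinearMap)
    ((isCompact_weakStar_iff φ).2 (isCompact_toWeak_simplex φ h))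
    (fun x : D '' simplex => ⟨D (S (B x)), S (B x), hS (hB x), rfl⟩)
    (hP _ fun x => ⟨B x, hB x, hBx x, rfl⟩)
  refine hfix (B x) (hB x) (D.injective ?_)
  rw [← hBx x]
  exact congrArg Subtype.val hx

theorem norm_cons_sub (a : ℝ) (b b' : Ell1) : ‖cons a b - cons a b'‖ = ‖b - b'‖ := by
  have : cons a b - cons a b' = cons 0 (b - b') := by
    refine lp.ext (funext fun i => ?_)
    cases i with
    | zero => exact sub_self a
    | succ n => rfl
  rw [this, norm_cons, abs_zero, zero_add]

theorem mapsTo_cons_zero : Set.MapsTo (cons 0) simplex simplex := by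
  rintro b ⟨hb0, hb1⟩
  refine ⟨?_, by rw [tsum_cons, hb1, zero_add]⟩
  rintro (_ | k)
  · exact le_rfl
  · exact hb0 k

/-- The right shift preserves norms and total mass, and a fixed point would have all coordinates
zero. -/
theorem not_hasFPP_isometric_of_copy {D : Ell1 →ₗᵢ[ℝ] Ell1} {c : Ell1}
    (h : IsWeakStarCopy φ D c) : ¬ HasFPP φ Isometric := by
  refine not_hasFPP_of_map_simplex φ h mapsTo_cons_zero ?_ ?_
  · rintro b ⟨-, hb1⟩ hb
    have h0 : ∀ k, b k = 0 := by
      intro k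
      induction k with
      | zero => rw [← hb, cons_zero]
      | succ k ih => rw [← hb, cons_succ, ih]
    simp [h0] at hb1
  · intro T hT x y
    obtain ⟨a, -, hxa, hTa⟩ := hT x
    obtain ⟨b, -, hyb, hTb⟩ := hT y
    rw [hTa, hTb, hxa, hyb, ← map_sub, ← map_sub, D.norm_map, D.norm_map, norm_cons_sub]

/-- The sequence `w` with `w 0 = 0` and `w (n + 1) = (w n + b n) / 2`. -/
def averageSeq (b : ℕ → ℝ) : ℕ → ℝ
  | 0 => 0
  | n + 1 => (averageSeq b n + b n) / 2

theorem sum_abs_averageSeq_le (b : Ell1) (N : ℕ) :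
    ∑ n ∈ Finset.range N, |averageSeq b n| ≤ ‖b‖ := by
  induction N with
  | zero => simp
  | succ N ih =>
    rw [Finset.sum_range_succ']
    have h1 : ∀ n, |averageSeq b (n + 1)| ≤ (|averageSeq b n| + |b n|) / 2 := fun n => by
      rw [averageSeq, abs_div, abs_two]
      have := abs_add_le (averageSeq b n) (b n)
      linarith
    have h2 : ∑ n ∈ Finset.range N, |b n| ≤ ‖b‖ :=
      sum_le_hasSum _ (fun i _ => abs_nonneg _) (hasSum_abs b)
    have h3 : ∑ n ∈ Finset.range N, |averageSeq b (n + 1)| ≤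
        (∑ n ∈ Finset.range N, |averageSeq b n| + ∑ n ∈ Finset.range N, |b n|) / 2 := by
      rw [← Finset.sum_add_distrib, Finset.sum_div]
      exact Finset.sum_le_sum fun n _ => h1 n
    simp only [averageSeq, abs_zero, add_zero] at h3 ⊢
    linarith

/-- The operator `b ↦ averageSeq b` of `ℓ₁`. -/
def average (b : Ell1) : Ell1 :=
  ofSummable (averageSeq b) (summable_of_sum_range_le (fun _ => abs_nonneg _)
    (sum_abs_averageSeq_le b))

theorem average_zero (b : Ell1) : average b 0 = 0 := rfl

theorem average_succ (b : Ell1) (n : ℕ) : average b (n + 1) = (average b n + b n) / 2 := rfl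

theorem average_sub (b b' : Ell1) : average (b - b') = average b - average b' := by
  refine lp.ext (funext fun n => ?_)
  induction n with
  | zero => simp [average_zero]
  | succ n ih =>
    have h : (average b - average b') n = average b n - average b' n := rfl
    have h' : (average b - average b') (n + 1) = average b (n + 1) - average b' (n + 1) := rfl
    have h'' : (b - b') n = b n - b' n := rfl
    rw [h', average_succ, average_succ, average_succ, ih, h, h'']
    ring

theorem tsum_average (b : Ell1) : ∑' n, average b n = ∑' n, b n := by
  have h := (summable_coord (average b)).tsum_eq_zero_add
  simp only [average_zero, average_succ, zero_add] at h
  rw [tsum_div_const, (summable_coord _).tsum_add (summable_coord b)] at h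
  linarith

theorem mapsTo_average : Set.MapsTo average simplex simplex := by
  rintro b ⟨hb0, hb1⟩
  refine ⟨fun n => ?_, by rw [tsum_average, hb1]⟩
  induction n with
  | zero => exact le_rfl
  | succ n ih =>
    rw [average_succ]
    linarith [hb0 n]

/-- Right after the first nonzero term of `d`, which is positive, `w` is positive. If signs never
conflicted, `w` would stay positive and `d` nonnegative, contradicting `∑ d n = 0`. -/
theorem exists_average_mul_neg_of_pos {w d : ℕ → ℝ} (hw0 : w 0 = 0)
    (hw : ∀ n, w (n + 1) = (w n + d n) / 2) (hd : Summable d) (hd0 : ∑' n, d n = 0) {m : ℕ}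
    (hm : 0 < d m) (hlt : ∀ k < m, d k = 0) : ∃ n, w n * d n < 0 := by
  by_contra! hc
  have hwz : ∀ n ≤ m, w n = 0 := by
    intro n
    induction n with
    | zero => exact fun _ => hw0
    | succ n ih => exact fun hn => by rw [hw, ih (by omega), hlt n (by omega)]; norm_num
  have hpos : ∀ n, 0 < w (m + 1 + n) := by
    intro n
    induction n with
    | zero => rw [add_zero, hw, hwz m le_rfl]; linarith
    | succ n ih =>
      rw [← add_assoc, hw]
      have := nonneg_of_mul_nonneg_right (hc (m + 1 + n)) ih
      linarith
  have hnn : ∀ n, 0 ≤ d n := by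
    intro n
    rcases lt_trichotomy n m with h | rfl | h
    · exact (hlt n h).ge
    · exact hm.le
    · obtain ⟨k, rfl⟩ := Nat.exists_eq_add_of_le (Nat.succ_le_of_lt h)
      exact nonneg_of_mul_nonneg_right (hc _) (hpos k)
  exact (hd.tsum_pos hnn m hm).ne' hd0

/-- The recursion gives `‖average d‖ ≤ (‖average d‖ + ‖d‖) / 2`, strictly as soon as the triangle
inequality is strict at one index; the zero sum, valid for differences of simplex points, provides
that index. -/
theorem norm_average_lt {d : Ell1} (hd : d ≠ 0) (hd0 : ∑' n, d n = 0) : ‖average d‖ < ‖d‖ := by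
  have hex : ∃ n, d n ≠ 0 := by
    by_contra! h
    exact hd (lp.ext (funext h))
  obtain ⟨n, hn⟩ : ∃ n, average d n * d n < 0 := by
    classical
    have hm := Nat.find_spec hex
    have hlt : ∀ k < Nat.find hex, d k = 0 := fun k hk => by
      simpa using Nat.find_min hex hk
    rcases lt_or_gt_of_ne hm with h | h
    · obtain ⟨n, hn⟩ := exists_average_mul_neg_of_pos (w := fun n => -average d n)
        (d := fun n => -d n) (by simp [average_zero])
        (fun n => by rw [average_succ]; ring) (summable_coord d).neg
        (by rw [tsum_neg, hd0, neg_zero])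
        (neg_pos.2 h) (fun k hk => by simp [hlt k hk])
      exact ⟨n, by simpa using hn⟩
    · exact exists_average_mul_neg_of_pos (average_zero d) (average_succ d) (summable_coord d) hd0
        h hlt
  have h1 := (summable_abs (average d)).tsum_eq_zero_add
  rw [(hasSum_abs _).tsum_eq, average_zero, abs_zero, zero_add] at h1
  have h2 : ∑' n, |average d (n + 1)| < ∑' n, (|average d n| + |d n|) / 2 := by
    refine Summable.tsum_lt_tsum (i := n) (fun k => ?_) ?_
      ((summable_nat_add_iff 1).2 (summable_abs _))
      (((summable_abs _).add (summable_abs d)).div_const 2)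
    · rw [average_succ, abs_div, abs_two]
      linarith [abs_add_le (average d k) (d k)]
    · rw [average_succ, abs_div, abs_two]
      have : |average d n + d n| < |average d n| + |d n| := by
        refine (abs_add_le _ _).lt_of_ne fun h => ?_
        rw [abs_add_eq_add_abs_iff] at h
        rcases h with ⟨ha, hb⟩ | ⟨ha, hb⟩
        · exact hn.not_ge (mul_nonneg ha hb)
        · exact hn.not_ge (mul_nonneg_of_nonpos_of_nonpos ha hb)
      linarith
  rw [tsum_div_const, (summable_abs _).tsum_add (summable_abs d), (hasSum_abs _).tsum_eq,
    (hasSum_abs _).tsum_eq, ← h1] at h2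
  linarith

theorem not_hasFPP_contractive_of_copy {D : Ell1 →ₗᵢ[ℝ] Ell1} {c : Ell1}
    (h : IsWeakStarCopy φ D c) : ¬ HasFPP φ Contractive := by
  refine not_hasFPP_of_map_simplex φ h mapsTo_average ?_ ?_
  · rintro b ⟨-, hb1⟩ hb
    have h0 : ∀ k, b k = 0 := by
      intro k
      induction k with
      | zero => rw [← hb, average_zero]
      | succ k ih => rw [← hb, average_succ, hb, ih]; norm_num
    simp [h0] at hb1
  · intro T hT x y hxy
    obtain ⟨a, ha, hxa, hTa⟩ := hT x
    obtain ⟨b, hb, hyb, hTb⟩ := hT y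
    rw [hTa, hTb, hxa, hyb, ← map_sub, ← map_sub, D.norm_map, D.norm_map, ← average_sub]
    refine norm_average_lt ?_ ?_
    · intro hab
      rw [sub_eq_zero] at hab
      exact hxy (Subtype.ext (by rw [hxa, hyb, hab]))
    · have : ∀ n, (a - b) n = a n - b n := fun n => rfl
      rw [tsum_congr this, (summable_coord a).tsum_sub (summable_coord b), ha.2, hb.2, sub_self]

end

section

/-! ### Operators with isometric adjoint are quotient maps -/

section Quotient

variable {E F : Type*} [NormedAddCommGroup E] [NormedSpace ℝ E] [NormedAddCommGroup F]
  [NormedSpace ℝ F]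

/-- If `y` were outside the closure of the image of the ball of radius `‖y‖`, a separating `ψ` would
satisfy `‖ψ.comp A‖ * ‖y‖ < ψ y`. -/
theorem exists_approx_preimage_of_dual {A : E →L[ℝ] F}
    (hA : ∀ (ψ : StrongDual ℝ F) (y : F), ψ y ≤ ‖ψ.comp A‖ * ‖y‖) {δ : ℝ} (hδ : 0 < δ) (y : F) :
    ∃ x, ‖y - A x‖ ≤ δ * ‖y‖ ∧ ‖x‖ ≤ ‖y‖ := by
  rcases eq_or_ne y 0 with rfl | hy
  · exact ⟨0, by simp, by simp⟩
  have hy0 : 0 < ‖y‖ := norm_pos_iff.2 hy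
  suffices h : y ∈ closure (A '' Metric.closedBall 0 ‖y‖) by
    obtain ⟨_, ⟨x, hx, rfl⟩, hd⟩ := Metric.mem_closure_iff.1 h (δ * ‖y‖) (by positivity)
    exact ⟨x, by rw [← dist_eq_norm]; exact hd.le, by simpa using hx⟩
  by_contra hcl
  obtain ⟨ψ, u, hu, huy⟩ := geometric_hahn_banach_closed_point
    ((convex_closedBall (0 : E) ‖y‖).linear_image A.toLinearMap).closure isClosed_closure hcl
  have hball : ∀ x, ‖x‖ ≤ ‖y‖ → ψ (A x) < u := fun x hx =>
    hu _ (subset_closure ⟨x, by simpa using hx, rfl⟩)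
  have hu0 : 0 < u := by simpa using hball 0 (by simp)
  have hnorm : ‖ψ.comp A‖ ≤ u / ‖y‖ := by
    refine ContinuousLinearMap.opNorm_le_of_unit_norm (by positivity) fun x hx => ?_
    have h1 := hball (‖y‖ • x) (by rw [norm_smul, hx, norm_norm, mul_one])
    have h2 := hball (-(‖y‖ • x)) (by rw [norm_neg, norm_smul, hx, norm_norm, mul_one])
    simp only [map_neg, map_smul, smul_eq_mul] at h1 h2
    rw [le_div_iff₀ hy0, ContinuousLinearMap.comp_apply, ← norm_norm y, ← norm_mul, mul_comm,
      Real.norm_eq_abs, abs_le]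
    constructor <;> linarith
  rw [le_div_iff₀ hy0] at hnorm
  linarith [hA ψ y]

/-- Successive correction, as in the open mapping theorem: each residual is at most `δ` times the
previous one, so the approximate preimages sum geometrically. -/
theorem exists_preimage_of_dual [CompleteSpace E] {A : E →L[ℝ] F}
    (hA : ∀ (ψ : StrongDual ℝ F) (y : F), ψ y ≤ ‖ψ.comp A‖ * ‖y‖) {δ : ℝ} (hδ : 0 < δ) (hδ1 : δ < 1)
    (y : F) :
    ∃ x, A x = y ∧ ‖x‖ ≤ ‖y‖ * (1 - δ)⁻¹ := by
  choose g hg1 hg2 using exists_approx_preimage_of_dual hA hδ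
  let h : F → F := fun y => y - A (g y)
  have hn : ∀ n, ‖h^[n] y‖ ≤ δ ^ n * ‖y‖ := by
    intro n
    induction n with
    | zero => simp
    | succ n ih =>
      rw [Function.iterate_succ_apply', pow_succ']
      calc ‖h (h^[n] y)‖ ≤ δ * ‖h^[n] y‖ := hg1 _
        _ ≤ δ * (δ ^ n * ‖y‖) := mul_le_mul_of_nonneg_left ih hδ.le
        _ = δ * δ ^ n * ‖y‖ := by ring
  have hgeo : HasSum (fun n : ℕ => ‖y‖ * δ ^ n) (‖y‖ * (1 - δ)⁻¹) :=
    (hasSum_geometric_of_lt_one hδ.le hδ1).mul_left _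
  have hb : ∀ n, ‖g (h^[n] y)‖ ≤ ‖y‖ * δ ^ n := fun n =>
    (hg2 _).trans ((hn n).trans_eq (mul_comm _ _))
  have hsum : Summable fun n => g (h^[n] y) := Summable.of_norm_bounded hgeo.summable hb
  refine ⟨∑' n, g (h^[n] y), ?_, tsum_of_norm_bounded hgeo hb⟩
  have hpart : ∀ N, A (∑ n ∈ Finset.range N, g (h^[n] y)) = y - h^[N] y := by
    intro N
    induction N with
    | zero => simp
    | succ N ih =>
      rw [Finset.sum_range_succ, map_add, ih, Function.iterate_succ_apply']
      simp only [h]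
      abel
  have h1 : Tendsto (fun N => A (∑ n ∈ Finset.range N, g (h^[n] y))) atTop
      (𝓝 (A (∑' n, g (h^[n] y)))) := (A.continuous.tendsto _).comp hsum.hasSum.tendsto_sum_nat
  have h2 : Tendsto (fun N => h^[N] y) atTop (𝓝 0) :=
    squeeze_zero_norm hn (by
      simpa using (tendsto_pow_atTop_nhds_zero_of_lt_one hδ.le hδ1).mul_const ‖y‖)
  simp_rw [hpart] at h1
  exact tendsto_nhds_unique h1 (by simpa using h2.const_sub y)

/-- A contraction from a Banach space to a subspace of a normed space whose adjoint does not
decrease norms induces an isometry of the quotient by its kernel. -/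
theorem nonempty_quotient_ker_equiv [CompleteSpace E] {V : Submodule ℝ F} {A : E →L[ℝ] V}
    (hA1 : ∀ x, ‖A x‖ ≤ ‖x‖)
    (hA : ∀ (ψ : StrongDual ℝ V) (y : V), ψ y ≤ ‖ψ.comp A‖ * ‖y‖) :
    Nonempty ((E ⧸ LinearMap.ker (A : E →ₗ[ℝ] V)) ≃ₗᵢ[ℝ] V) := by
  have hsurj : Function.Surjective (A : E →ₗ[ℝ] V) := fun y => by
    obtain ⟨x, hx, -⟩ := exists_preimage_of_dual hA one_half_pos one_half_lt_one y
    exact ⟨x, hx⟩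
  refine ⟨⟨LinearMap.quotKerEquivOfSurjective (A : E →ₗ[ℝ] V) hsurj, fun q => ?_⟩⟩
  have hmk : ∀ x, LinearMap.quotKerEquivOfSurjective (A : E →ₗ[ℝ] V) hsurj
      (Submodule.Quotient.mk x) = A x := fun x => rfl
  apply le_antisymm
  · refine le_of_forall_pos_le_add fun ε hε => ?_
    obtain ⟨m, rfl, hm⟩ := Submodule.Quotient.norm_mk_lt q hε
    rw [hmk]
    exact (hA1 m).trans hm.le
  · obtain ⟨x, rfl⟩ := Submodule.Quotient.mk_surjective _ q
    rw [hmk]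
    have hδ : ∀ δ : ℝ, 0 < δ → δ < 1 →
        ‖(Submodule.Quotient.mk x : E ⧸ LinearMap.ker (A : E →ₗ[ℝ] V))‖ ≤ ‖A x‖ * (1 - δ)⁻¹ := by
      intro δ h0 h1
      obtain ⟨x', hx', hn⟩ := exists_preimage_of_dual hA h0 h1 (A x)
      have : (Submodule.Quotient.mk x : E ⧸ LinearMap.ker (A : E →ₗ[ℝ] V)) =
          Submodule.Quotient.mk x' := by
        rw [Submodule.Quotient.eq, LinearMap.mem_ker, map_sub, sub_eq_zero]
        exact hx'.symm
      rw [this]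
      exact (Submodule.Quotient.norm_mk_le _ x').trans hn
    have hlim : Tendsto (fun δ : ℝ => ‖A x‖ * (1 - δ)⁻¹) (𝓝[>] 0) (𝓝 (‖A x‖ * (1 - 0)⁻¹)) := by
      refine Tendsto.const_mul _ (Tendsto.inv₀ ?_ (by norm_num))
      exact (tendsto_nhdsWithin_of_tendsto_nhds tendsto_id).const_sub 1
    rw [sub_zero, inv_one, mul_one] at hlim
    refine ge_of_tendsto hlim ?_
    filter_upwards [Ioo_mem_nhdsGT (zero_lt_one' ℝ)] with δ hδ'
    exact hδ δ hδ'.1 hδ'.2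

end Quotient

/-! ### The space of convergent sequences -/

/-- The element of `c` given by a convergent sequence. -/
def ofTendsto (a : ℕ → ℝ) {l : ℝ} (h : Tendsto a atTop (𝓝 l)) : spaceC :=
  ⟨⟨a, memℓp_infty h.norm.bddAbove_range⟩, l, h⟩

theorem limC_eq {x : spaceC} {l : ℝ} (h : Tendsto (fun n => (x : EllInf) n) atTop (𝓝 l)) :
    limC x = l := tendsto_nhds_unique (tendsto_limC x) h

theorem limC_ofTendsto (a : ℕ → ℝ) {l : ℝ} (h : Tendsto a atTop (𝓝 l)) :
    limC (ofTendsto a h) = l := limC_eq h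

theorem spaceC_ext {x y : spaceC} (h : ∀ n, (x : EllInf) n = (y : EllInf) n) : x = y :=
  Subtype.ext (lp.ext (funext h))

theorem abs_coord_le (x : spaceC) (n : ℕ) : |(x : EllInf) n| ≤ ‖x‖ :=
  lp.norm_apply_le_norm ENNReal.top_ne_zero (x : EllInf) n

theorem norm_spaceC_le {x : spaceC} {M : ℝ} (hM : 0 ≤ M) (h : ∀ n, |(x : EllInf) n| ≤ M) :
    ‖x‖ ≤ M :=
  lp.norm_le_of_forall_le hM h

theorem summable_mul_coord (h : Ell1) (x : spaceC) : Summable fun n => h n * (x : EllInf) n :=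
  Summable.of_norm_bounded ((summable_abs h).mul_right ‖x‖) fun n => by
    rw [norm_mul]
    exact mul_le_mul_of_nonneg_left (abs_coord_le x n) (norm_nonneg _)

theorem abs_tsum_mul_coord_le (h : Ell1) (x : spaceC) :
    |∑' n, h n * (x : EllInf) n| ≤ ‖h‖ * ‖x‖ := by
  refine tsum_of_norm_bounded (f := fun n => h n * (x : EllInf) n)
    ((hasSum_abs h).mul_right ‖x‖) fun n => ?_
  rw [norm_mul]
  exact mul_le_mul_of_nonneg_left (abs_coord_le x n) (norm_nonneg _)

/-- The coordinate functionals of `c`. -/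
def coordC (n : ℕ) : spaceC →ₗ[ℝ] ℝ where
  toFun x := (x : EllInf) n
  map_add' _ _ := rfl
  map_smul' _ _ := rfl

/-- The unit vectors of `c`. -/
def unitC (n : ℕ) : spaceC :=
  ofTendsto (fun k => if k = n then 1 else 0) (l := 0)
    (tendsto_const_nhds.congr' (by
      filter_upwards [eventually_gt_atTop n] with k hk
      rw [if_neg hk.ne']))

theorem sum_smul_unitC_apply (a : ℕ → ℝ) (N n : ℕ) :
    ((∑ k ∈ Finset.range N, a k • unitC k : spaceC) : EllInf) n = if n < N then a n else 0 := by
  change coordC n _ = _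
  rw [map_sum]
  have : ∀ k, coordC n (a k • unitC k) = if n = k then a k else 0 := fun k => by
    rw [map_smul]
    change a k * (if n = k then 1 else 0) = _
    split_ifs <;> simp
  simp [this]

/-- The functionals on `c` are given by the elements of `ℓ₁` and the limit. -/
theorem exists_dual_spaceC_eq (ψ : StrongDual ℝ spaceC) :
    ∃ (r : ℝ) (g : Ell1), ∀ x : spaceC, ψ x = r * limC x + ∑' n, g n * (x : EllInf) n := by
  have hb : ∀ N, ∑ n ∈ Finset.range N, |ψ (unitC n)| ≤ ‖ψ‖ := by
    intro N
    let a : ℕ → ℝ := fun n => SignType.sign (ψ (unitC n))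
    have h1 : ψ (∑ n ∈ Finset.range N, a n • unitC n) =
        ∑ n ∈ Finset.range N, |ψ (unitC n)| := by
      rw [map_sum]
      exact Finset.sum_congr rfl fun n _ => by
        rw [map_smul, smul_eq_mul]
        exact sign_mul_self _
    have ha : ∀ n, |a n| ≤ 1 := fun n => by
      simp only [a]
      rcases lt_trichotomy (ψ (unitC n)) 0 with h | h | h <;> simp [h]
    have h2 : ‖∑ n ∈ Finset.range N, a n • unitC n‖ ≤ 1 :=
      norm_spaceC_le zero_le_one fun n => by
        rw [sum_smul_unitC_apply]
        split_ifs
        · exact ha n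
        · simp
    rw [← h1]
    exact (le_abs_self _).trans ((ψ.le_opNorm_of_le h2).trans_eq (mul_one _))
  let g : Ell1 := ofSummable (fun n => ψ (unitC n))
    (summable_of_sum_range_le (fun _ => abs_nonneg _) hb)
  let one : spaceC := ofTendsto (fun _ => 1) (l := 1) tendsto_const_nhds
  -- Here `x - L • one` is a null sequence, on which `ψ` acts through `g` alone; the coefficient of
  -- the limit is what remains of `ψ one`.
  refine ⟨ψ one - ∑' n, g n, g, fun x => ?_⟩
  set L := limC x
  have happrox : Tendsto (fun N => ∑ n ∈ Finset.range N, ((x : EllInf) n - L) • unitC n + L • one)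
      atTop (𝓝 x) := by
    rw [Metric.tendsto_atTop]
    intro ε hε
    obtain ⟨N₀, hN₀⟩ := Metric.tendsto_atTop.1 (tendsto_limC x) (ε / 2) (half_pos hε)
    refine ⟨N₀, fun N hN => ?_⟩
    rw [dist_comm, dist_eq_norm]
    refine (norm_spaceC_le (half_pos hε).le fun n => ?_).trans_lt (half_lt_self hε)
    have h1 : ((x - (∑ n ∈ Finset.range N, ((x : EllInf) n - L) • unitC n + L • one) : spaceC) :
        EllInf) n = (x : EllInf) n - ((if n < N then (x : EllInf) n - L else 0) + L * 1) := by
      have h2 := sum_smul_unitC_apply (fun n => (x : EllInf) n - L) N n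
      rw [← h2]
      rfl
    rw [h1]
    split_ifs with h
    · simp [(half_pos hε).le]
    · have := hN₀ n (by omega)
      rw [Real.dist_eq] at this
      simpa using this.le
  have hsumx := summable_mul_coord g x
  have hsum : HasSum (fun n => ((x : EllInf) n - L) * g n)
      (∑' n, g n * (x : EllInf) n - L * ∑' n, g n) := by
    refine (hsumx.hasSum.sub ((summable_coord g).hasSum.mul_left L)).congr_fun fun n => ?_
    ring
  have h1 := (ψ.continuous.tendsto x).comp happrox
  have h2 := hsum.tendsto_sum_nat.add_const (L * ψ one)
  have h3 : ∀ N, (ψ ∘ fun N => ∑ n ∈ Finset.range N, ((x : EllInf) n - L) • unitC n + L • one) N =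
      ∑ n ∈ Finset.range N, ((x : EllInf) n - L) * g n + L * ψ one := fun N => by
    simp only [Function.comp, map_add, map_sum, map_smul, smul_eq_mul]
    rfl
  rw [tendsto_nhds_unique (h1.congr h3) h2]
  ring

/-! ### Quotients isometric to hyperplanes of `c` -/

/-- A normal form: the hyperplane is the set of sequences whose limit is their pairing with `c`,
just as the basis of a weak* copy converges to `D c`. -/
theorem mem_W_cons_iff {c : Ell1} {a : ℝ} (ha : a ≠ 0) {x : spaceC} :
    x ∈ W (cons a ((-a) • c)) ↔ limC x = ∑' n, c n * (x : EllInf) n := by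
  have h : pairing (cons a ((-a) • c)) x = a * limC x + ∑' n, -a * (c n * (x : EllInf) n) := by
    change a * limC x + ∑' n, (-a * c n) * (x : EllInf) n = _
    simp_rw [mul_assoc]
  rw [W, LinearMap.mem_ker, h, tsum_mul_left]
  constructor
  · intro h0
    have : a * (limC x - ∑' n, c n * (x : EllInf) n) = 0 := by linarith
    exact sub_eq_zero.1 ((mul_eq_zero.1 this).resolve_left ha)
  · intro h0
    rw [h0]
    ring

variable (φ : StrongDual ℝ X ≃ₗᵢ[ℝ] Ell1)

/-- Evaluating the copy's basis at `z` gives a sequence in the hyperplane. A functional on the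
hyperplane is the pairing with some `h : Ell1`, the limit being absorbed by `c`; its pullback to `X`
is `D h`, of norm `‖h‖`, which dominates the norm of the functional. -/
theorem exists_quotient_equiv_of_copy [CompleteSpace X] {D : Ell1 →ₗᵢ[ℝ] Ell1} {c : Ell1}
    (h : IsWeakStarCopy φ D c) :
    ∃ Y : Submodule ℝ X, IsClosed (Y : Set X) ∧
      ∃ f : Ell1, IsBad f ∧ Nonempty ((X ⧸ Y) ≃ₗᵢ[ℝ] W f) := by
  obtain ⟨⟨hc0, hc1⟩, hlim⟩ := h
  have hcn : ‖c‖ = 1 := by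
    rw [← hc1, ← (hasSum_abs c).tsum_eq]
    exact tsum_congr fun i => abs_of_nonneg (hc0 i)
  have ha : (1 / 2 : ℝ) ≠ 0 := by norm_num
  set f : Ell1 := cons (1 / 2) ((-(1 / 2) : ℝ) • c) with hf
  have hmem : ∀ z : X, ofTendsto (fun n => φ.symm (D (stdBasis n)) z) (hlim z) ∈ W f := fun z => by
    rw [hf, mem_W_cons_iff ha, limC_ofTendsto]
    exact (hasSum_copy_apply φ D c z).tsum_eq.symm
  let A₀ : X →ₗ[ℝ] W f :=
    { toFun z := ⟨_, hmem z⟩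
      map_add' z z' := Subtype.ext (spaceC_ext fun n => map_add (φ.symm (D (stdBasis n))) z z')
      map_smul' r z := Subtype.ext (spaceC_ext fun n => map_smul (φ.symm (D (stdBasis n))) r z) }
  have hA₀ : ∀ z, ‖A₀ z‖ ≤ ‖z‖ := fun z =>
    norm_spaceC_le (norm_nonneg z) fun n => by
      have := abs_dual_apply_le φ (D (stdBasis n)) z
      rwa [D.norm_map, norm_stdBasis, one_mul] at this
  let A : X →L[ℝ] W f := A₀.mkContinuous 1 fun z => by rw [one_mul]; exact hA₀ z
  have hA : ∀ (ψ : StrongDual ℝ (W f)) (w : W f), ψ w ≤ ‖ψ.comp A‖ * ‖w‖ := by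
    intro ψ w
    obtain ⟨ψ', hψ', -⟩ := exists_extension_norm_eq (W f) ψ
    obtain ⟨r, g, hrg⟩ := exists_dual_spaceC_eq ψ'
    have hψ : ∀ w : W f, ψ w = ∑' n, (r • c + g) n * ((w : spaceC) : EllInf) n := by
      intro w
      have hw : limC (w : spaceC) = ∑' n, c n * ((w : spaceC) : EllInf) n :=
        (mem_W_cons_iff ha).1 w.2
      rw [← hψ', hrg, hw, ← tsum_mul_left,
        ← ((summable_mul_coord c w).mul_left r).tsum_add (summable_mul_coord g w)]
      refine tsum_congr fun n => ?_
      change _ = (r * c n + g n) * _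
      ring
    have hcomp : ψ.comp A = φ.symm (D (r • c + g)) := by
      ext z
      rw [← (hasSum_copy_apply φ D (r • c + g) z).tsum_eq]
      exact hψ _
    rw [hcomp, φ.symm.norm_map, D.norm_map]
    rw [hψ]
    exact (le_abs_self _).trans (abs_tsum_mul_coord_le _ _)
  refine ⟨LinearMap.ker (A : X →ₗ[ℝ] W f), A.isClosed_ker, f, ⟨?_, ?_, ?_⟩,
    nonempty_quotient_ker_equiv (A := A) hA₀ hA⟩
  · rw [hf, norm_cons, norm_smul, hcn]
    norm_num
  · rw [hf, cons_zero]
    norm_num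
  · refine Set.infinite_univ.mono fun n _ => ?_
    change (1 / 2 : ℝ) * (-(1 / 2) * c n) ≤ 0
    linarith [hc0 n]

end

section

/-! ### Hyperplanes of `c` inside quotients -/

/-- The leading coordinate carries half of the norm, so dividing the tail by `-f 0` gives norm one
and turns the sign condition into `0 ≤ c n`. -/
theorem IsBad.exists_eq_cons {f : Ell1} (hf : IsBad f) :
    ∃ (a : ℝ) (c : Ell1), a ≠ 0 ∧ ‖c‖ = 1 ∧ {n | 0 ≤ c n}.Infinite ∧ f = cons a ((-a) • c) := by
  obtain ⟨hn, h0, hinf⟩ := hf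
  have ha : f 0 ≠ 0 := fun h => by norm_num [h] at h0
  let b : Ell1 := ofSummable (fun n => f (n + 1)) ((summable_nat_add_iff 1).2 (summable_abs f))
  have hfb : f = cons (f 0) b := lp.ext (funext fun i => by cases i <;> rfl)
  have hb : ‖b‖ = 1 / 2 := by
    rw [hfb, norm_cons, h0] at hn
    linarith
  refine ⟨f 0, (-f 0)⁻¹ • b, ha, ?_, hinf.mono fun n hn => ?_, ?_⟩
  · rw [norm_smul, hb, norm_inv, norm_neg, Real.norm_eq_abs, h0]
    norm_num
  · have hn' : f 0 * f (n + 1) ≤ 0 := hn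
    change 0 ≤ (-f 0)⁻¹ * f (n + 1)
    have h1 : (-f 0)⁻¹ * f (n + 1) = -(f 0 * f (n + 1)) / (f 0) ^ 2 := by
      field_simp
    rw [h1]
    exact div_nonneg (by linarith) (sq_nonneg _)
  · rw [smul_inv_smul₀ (neg_ne_zero.2 ha)]
    exact hfb

/-- A vector of the unit ball of a hyperplane of `c` with finitely many prescribed coordinates,
constant afterwards. -/
theorem exists_mem_W_cons {a : ℝ} (ha : a ≠ 0) {c : Ell1} (hc : ‖c‖ = 1) {N : ℕ}
    (hN : ∑' k, |c (k + N)| < 1) {v : ℕ → ℝ} (hv : ∀ n, |v n| ≤ 1) :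
    ∃ w : W (cons a ((-a) • c)), ‖w‖ ≤ 1 ∧ (∀ n < N, ((w : spaceC) : EllInf) n = v n) ∧
      ∀ n, N ≤ n → ((w : spaceC) : EllInf) n =
        (∑ n ∈ Finset.range N, c n * v n) / (1 - ∑' k, c (k + N)) := by
  set ρ := ∑' k, |c (k + N)| with hρ
  set r := ∑' k, c (k + N) with hr
  -- The constant tail is forced by `l = ∑ n < N, c n * v n + r * l`; it satisfies `|l| ≤ (1 - ρ) /
  -- (1 - r) ≤ 1`.
  set l := (∑ n ∈ Finset.range N, c n * v n) / (1 - r) with hl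
  have hs : Summable fun k => |c (k + N)| := (summable_nat_add_iff N).2 (summable_abs c)
  have hrρ : |r| ≤ ρ := by
    have := norm_tsum_le_tsum_norm (f := fun k => c (k + N)) hs
    exact this
  have h1r : 0 < 1 - r := by linarith [le_abs_self r]
  have hsum : ∑ n ∈ Finset.range N, |c n| = 1 - ρ := by
    have := (summable_abs c).sum_add_tsum_nat_add N
    rw [(hasSum_abs c).tsum_eq, hc] at this
    linarith
  have hl1 : |l| ≤ 1 := by
    rw [hl, abs_div, abs_of_pos h1r, div_le_one h1r]
    have h1 : |∑ n ∈ Finset.range N, c n * v n| ≤ ∑ n ∈ Finset.range N, |c n| := by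
      refine (Finset.abs_sum_le_sum_abs _ _).trans (Finset.sum_le_sum fun n _ => ?_)
      rw [abs_mul]
      exact mul_le_of_le_one_right (abs_nonneg _) (hv n)
    linarith [le_abs_self r]
  have hlim : Tendsto (fun n => if n < N then v n else l) atTop (𝓝 l) :=
    tendsto_const_nhds.congr' (by
      filter_upwards [eventually_ge_atTop N] with n hn
      rw [if_neg hn.not_gt])
  let x : spaceC := ofTendsto _ hlim
  have hx : ∀ n, (x : EllInf) n = if n < N then v n else l := fun n => rfl
  refine ⟨⟨x, ?_⟩, ?_, fun n hn => ?_, fun n hn => ?_⟩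
  · rw [mem_W_cons_iff ha, limC_ofTendsto, ← (summable_mul_coord c x).sum_add_tsum_nat_add N]
    have h1 : ∑ n ∈ Finset.range N, c n * (x : EllInf) n = (1 - r) * l := by
      rw [hl, mul_div_cancel₀ _ h1r.ne']
      exact Finset.sum_congr rfl fun n hn => by rw [hx, if_pos (Finset.mem_range.1 hn)]
    have h2 : ∑' k, c (k + N) * (x : EllInf) (k + N) = r * l := by
      rw [hr, ← tsum_mul_right]
      exact tsum_congr fun k => by rw [hx, if_neg (by omega)]
    rw [h1, h2]
    ring
  · refine norm_spaceC_le zero_le_one fun n => ?_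
    change |if n < N then v n else l| ≤ 1
    split_ifs
    · exact hv n
    · exact hl1
  · exact (hx n).trans (if_pos hn)
  · exact (hx n).trans (if_neg hn.not_gt)

variable (φ : StrongDual ℝ X ≃ₗᵢ[ℝ] Ell1)

/-- Coordinates of a subspace of `c` embedded in a quotient of `X` extend to the unit ball
of `ℓ₁`. -/
theorem exists_extension_coord {Y : Submodule ℝ X} {V : Submodule ℝ spaceC}
    (J : V →ₗᵢ[ℝ] (X ⧸ Y)) (m : ℕ) :
    ∃ x : Ell1, ‖x‖ ≤ 1 ∧ ∀ (w : V) (z : X), Submodule.Quotient.mk z = J w →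
      φ.symm x z = ((w : spaceC) : EllInf) m := by
  let p : Submodule ℝ (X ⧸ Y) := LinearMap.range J.toLinearMap
  let ι : V ≃ₗ[ℝ] p := LinearEquiv.ofInjective J.toLinearMap J.injective
  have hι : ∀ q : p, ‖ι.symm q‖ = ‖q‖ := fun q => by
    obtain ⟨w, rfl⟩ := ι.surjective q
    rw [LinearEquiv.symm_apply_apply]
    exact (J.norm_map w).symm
  let ψ₀ : p →ₗ[ℝ] ℝ := (coordC m).comp (V.subtype.comp ι.symm.toLinearMap)
  have hψ₀ : ∀ q, ‖ψ₀ q‖ ≤ 1 * ‖q‖ := fun q => by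
    rw [one_mul, ← hι q]
    exact abs_coord_le _ m
  obtain ⟨ψ, hψ, hψn⟩ := exists_extension_norm_eq p (ψ₀.mkContinuous 1 hψ₀)
  have hψ1 : ‖ψ‖ ≤ 1 := hψn.trans_le (ψ₀.mkContinuous_norm_le zero_le_one hψ₀)
  let ζ : StrongDual ℝ X := (ψ.toLinearMap.comp Y.mkQ).mkContinuous 1 fun z => by
    rw [one_mul]
    calc ‖ψ (Y.mkQ z)‖ ≤ ‖ψ‖ * ‖Y.mkQ z‖ := ψ.le_opNorm _
      _ ≤ 1 * ‖z‖ := mul_le_mul hψ1 (Submodule.Quotient.norm_mk_le Y z) (norm_nonneg _) zero_le_one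
      _ = ‖z‖ := one_mul _
  refine ⟨φ ζ, ?_, fun w z hz => ?_⟩
  · rw [φ.norm_map]
    exact LinearMap.mkContinuous_norm_le _ zero_le_one _
  · rw [φ.symm_apply_apply]
    change ψ (Submodule.Quotient.mk z) = _
    rw [hz]
    refine (hψ (ι w)).trans ?_
    change coordC m ((ι.symm (ι w) : V) : spaceC) = _
    rw [LinearEquiv.symm_apply_apply]
    rfl

/-- Two elements of the unit ball of `ℓ₁` whose sum and difference have norm two are disjoint. -/
theorem eq_zero_or_eq_zero_of_norm {x y : Ell1} (hx : ‖x‖ ≤ 1) (hy : ‖y‖ ≤ 1)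
    (hadd : 2 ≤ ‖x + y‖) (hsub : 2 ≤ ‖x - y‖) (i : ℕ) : x i = 0 ∨ y i = 0 := by
  have h1 : |x i| + |y i| - |x i + y i| ≤ ‖x‖ + ‖y‖ - ‖x + y‖ :=
    le_hasSum (((hasSum_abs x).add (hasSum_abs y)).sub (hasSum_abs (x + y))) i
      fun j _ => sub_nonneg.2 (abs_add_le (x j) (y j))
  have h2 : |x i| + |y i| - |x i - y i| ≤ ‖x‖ + ‖y‖ - ‖x - y‖ :=
    le_hasSum (((hasSum_abs x).add (hasSum_abs y)).sub (hasSum_abs (x - y))) i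
      fun j _ => sub_nonneg.2 (norm_sub_le (x j) (y j))
  have h3 : |x i| + |y i| ≤ |x i + y i| := by linarith
  have h4 : |x i| + |y i| ≤ |x i - y i| := by linarith
  -- Adding the two squared inequalities cancels the mixed product `x i * y i`.
  have h5 := mul_self_le_mul_self (by positivity) h3
  have h6 := mul_self_le_mul_self (by positivity) h4
  rw [abs_mul_abs_self] at h5 h6
  have h7 := abs_mul_abs_self (x i)
  have h8 := abs_mul_abs_self (y i)
  have h9 : |x i| * |y i| = 0 := by
    have : 0 ≤ |x i| * |y i| := by positivity
    nlinarith
  simpa using mul_eq_zero.1 h9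

/-- The extended coordinates `x m` are disjoint, hence null coordinatewise. Restricting to indices
with `0 ≤ c n` makes the norming vectors take the value one there, without a change of sign. -/
theorem hasNormOneLimit_of_embedding {Y : Submodule ℝ X} {f : Ell1} (hf : IsBad f)
    (J : W f →ₗᵢ[ℝ] (X ⧸ Y)) : HasNormOneLimit φ := by
  obtain ⟨a, c, ha, hc, hinf, rfl⟩ := hf.exists_eq_cons
  choose x hx1 hxw using exists_extension_coord φ J
  have htail : Tendsto (fun N => ∑' k, |c (k + N)|) atTop (𝓝 0) :=
    tendsto_sum_nat_add fun n => |c n|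
  obtain ⟨N₀, hN₀⟩ := eventually_atTop.1 (htail.eventually (gt_mem_nhds zero_lt_one))
  have hdisj : ∀ m m', m ≠ m' → ∀ i, x m i = 0 ∨ x m' i = 0 := by
    intro m m' hmm
    -- Test on a lift, of norm close to one, of a vector with coordinates `1` at `m` and `σ` at
    -- `m'`: the value is `1 + σ * σ = 2`.
    have hlow : ∀ σ : ℝ, |σ| = 1 → 2 ≤ ‖x m + σ • x m'‖ := by
      intro σ hσ
      obtain ⟨w, hw1, hwv, -⟩ := exists_mem_W_cons ha hc
        (hN₀ (N₀ + m + m' + 1) (by omega)) (v := fun n => if n = m then 1 else σ)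
        (fun n => by split_ifs <;> simp [hσ])
      have h1 := hwv m (by omega)
      have h2 := hwv m' (by omega)
      simp only [if_true, if_neg hmm.symm] at h1 h2
      refine le_of_forall_pos_le_add fun ε hε => ?_
      obtain ⟨z, hz, hzn⟩ := Submodule.Quotient.norm_mk_lt (J w) (half_pos hε)
      have h3 : φ.symm (x m + σ • x m') z = 2 := by
        have hσ2 : σ * σ = 1 := by rw [← abs_mul_abs_self, hσ, one_mul]
        rw [map_add, map_smul, add_apply, smul_apply, hxw m w z hz, hxw m' w z hz, h1, h2,
          smul_eq_mul, hσ2]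
        norm_num
      have h4 := dual_apply_le φ (x m + σ • x m') z
      rw [h3] at h4
      rw [J.norm_map] at hzn
      have h5 : ‖x m + σ • x m'‖ ≤ 2 := by
        refine (norm_add_le _ _).trans ?_
        rw [norm_smul, Real.norm_eq_abs, hσ, one_mul]
        linarith [hx1 m, hx1 m']
      have h6 : ‖x m + σ • x m'‖ * ‖z‖ ≤ ‖x m + σ • x m'‖ * (1 + ε / 2) :=
        mul_le_mul_of_nonneg_left (by linarith) (norm_nonneg _)
      nlinarith
    exact eq_zero_or_eq_zero_of_norm (hx1 m) (hx1 m') (by simpa using hlow 1 (by simp))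
      (by simpa [sub_eq_add_neg] using hlow (-1) (by simp))
  let sgn : ℕ → ℝ := fun n => if 0 ≤ c n then 1 else -1
  have hsgn : ∀ n, c n * sgn n = |c n| := fun n => by
    simp only [sgn]
    split_ifs with h
    · rw [mul_one, abs_of_nonneg h]
    · rw [mul_neg_one, abs_of_neg (not_le.1 h)]
  -- Following the signs of `c` up to `N₀ + j` makes the constant tail as large as possible; it is
  -- at least `(1 - ρ) / (1 + ρ)`, with `ρ` the remaining mass of `|c|`, and this tends to one.
  have hw : ∀ j, ∃ w : W (cons a ((-a) • c)), ‖w‖ ≤ 1 ∧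
      (∀ n < N₀ + j, ((w : spaceC) : EllInf) n = sgn n) ∧ ∀ n, N₀ + j ≤ n →
        (1 - ∑' k, |c (k + (N₀ + j))|) / (1 + ∑' k, |c (k + (N₀ + j))|) ≤
          ((w : spaceC) : EllInf) n := by
    intro j
    have hρ1 := hN₀ (N₀ + j) (by omega)
    obtain ⟨w, hw1, hwv, hwt⟩ := exists_mem_W_cons ha hc hρ1 (v := sgn)
      (fun n => by simp only [sgn]; split_ifs <;> simp)
    refine ⟨w, hw1, hwv, fun n hn => ?_⟩
    rw [hwt n hn, Finset.sum_congr rfl fun n _ => hsgn n]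
    have hs := (summable_nat_add_iff (N₀ + j)).2 (summable_abs c)
    have hsum := (summable_abs c).sum_add_tsum_nat_add (N₀ + j)
    rw [(hasSum_abs c).tsum_eq, hc] at hsum
    have hr : |∑' k, c (k + (N₀ + j))| ≤ ∑' k, |c (k + (N₀ + j))| :=
      norm_tsum_le_tsum_norm (f := fun k => c (k + (N₀ + j))) hs
    rw [eq_sub_of_add_eq hsum]
    refine div_le_div_of_nonneg_left (by linarith) ?_ ?_
    · linarith [le_abs_self (∑' k, c (k + (N₀ + j)))]
    · linarith [neg_abs_le (∑' k, c (k + (N₀ + j)))]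
  choose w hw1 hwv hwt using hw
  have hη : ∀ j : ℕ, 0 < 1 / ((j : ℝ) + 1) := fun j => Nat.one_div_pos_of_nat
  choose z hzw hzn using fun j : ℕ => Submodule.Quotient.norm_mk_lt (J (w j)) (hη j)
  -- Rescales the lifts into the unit ball at a cost that vanishes in the limit.
  let s : ℕ → ℝ := fun j => (1 + 1 / ((j : ℝ) + 1))⁻¹
  have hs0 : ∀ j, 0 < s j := fun j => inv_pos.2 (by linarith [hη j])
  have hs : Tendsto s atTop (𝓝 1) := by
    have h := (tendsto_one_div_add_atTop_nhds_zero_nat (𝕜 := ℝ)).const_add 1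
    rw [add_zero] at h
    have h' := h.inv₀ one_ne_zero
    rwa [inv_one] at h'
  have hval : ∀ m j, φ.symm (x m) (s j • z j) = s j * ((w j : spaceC) : EllInf) m := fun m j => by
    rw [map_smul, smul_eq_mul, hxw m (w j) (z j) (hzw j)]
  have htail' : Tendsto (fun j => ∑' k, |c (k + (N₀ + j))|) atTop (𝓝 0) :=
    htail.comp (tendsto_add_atTop_nat N₀ |>.congr fun j => add_comm j N₀)
  let n : ℕ → ℕ := Nat.nth fun n => 0 ≤ c n
  have hn : StrictMono n := Nat.nth_strictMono hinf
  have hnc : ∀ k, 0 ≤ c (n k) := fun k => Nat.nth_mem_of_infinite hinf k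
  refine hasNormOneLimit_of_norming φ (x := fun k => x (n k)) (fun k => hx1 _) (fun i => ?_)
    (z := fun j => s j • z j) (fun j => ?_) (fun k => ?_)
    (a := fun j => s j * ((1 - ∑' k, |c (k + (N₀ + j))|) / (1 + ∑' k, |c (k + (N₀ + j))|)))
    ?_ (fun j => ?_)
  · refine tendsto_const_nhds.congr' ?_
    by_cases h : ∃ k, x (n k) i ≠ 0
    · obtain ⟨k, hk⟩ := h
      filter_upwards [eventually_gt_atTop k] with l hl
      exact ((hdisj (n l) (n k) (hn hl).ne' i).resolve_right hk).symm
    · push Not at h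
      exact Eventually.of_forall fun k => (h k).symm
  · rw [norm_smul, Real.norm_of_nonneg (hs0 j).le, inv_mul_le_one₀ (by linarith [hη j])]
    have := hzn j
    rw [J.norm_map] at this
    linarith [hw1 j]
  · refine hs.congr' ?_
    filter_upwards [eventually_gt_atTop (n k)] with j hj
    rw [hval, hwv j (n k) (by omega)]
    simp [sgn, hnc k]
  · have h1 := (htail'.const_sub 1).div (htail'.const_add 1) (by norm_num)
    simpa using hs.mul h1
  · filter_upwards [eventually_ge_atTop (N₀ + j)] with m hm
    rw [hval]
    exact mul_le_mul_of_nonneg_left (hwt j (n m) (hm.trans (hn.id_le m))) (hs0 j).le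

end

end WeakStarFPP

end

/-! ### The equivalence of the six conditions -/

theorem theorem4p1 {X : Type*} [NormedAddCommGroup X] [NormedSpace ℝ X] [CompleteSpace X]
    (φ : StrongDual ℝ X ≃ₗᵢ[ℝ] WeakStarFPP.Ell1) :
    List.TFAE [
      ¬ WeakStarFPP.HasFPP φ WeakStarFPP.Nonexpansive,
      ¬ WeakStarFPP.HasFPP φ WeakStarFPP.Isometric,
      ¬ WeakStarFPP.HasFPP φ WeakStarFPP.Contractive,
      ∃ n : ℕ → ℕ, StrictMono n ∧ ∃ e : WeakStarFPP.Ell1, ‖e‖ = 1 ∧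
        Tendsto (fun k => WeakStarFPP.stdBasis (n k)) atTop
          (@nhds WeakStarFPP.Ell1 (WeakStarFPP.weakStar φ) e) ∧
        ∀ k, 0 ≤ e (n k),
      ∃ Y : Submodule ℝ X, IsClosed (Y : Set X) ∧
        ∃ f : WeakStarFPP.Ell1, WeakStarFPP.IsBad f ∧
          Nonempty ((X ⧸ Y) ≃ₗᵢ[ℝ] WeakStarFPP.W f),
      ∃ Y : Submodule ℝ X, IsClosed (Y : Set X) ∧
        ∃ g : WeakStarFPP.Ell1, WeakStarFPP.IsBad g ∧
          Nonempty (WeakStarFPP.W g →ₗᵢ[ℝ] (X ⧸ Y))] := by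
  tfae_have 1 → 4 := WeakStarFPP.hasNormOneLimit_of_not_hasFPP_nonexpansive φ
  tfae_have 4 → 2 := fun h => by
    obtain ⟨D, c, hD⟩ := WeakStarFPP.exists_isWeakStarCopy φ h
    exact WeakStarFPP.not_hasFPP_isometric_of_copy φ hD
  tfae_have 4 → 3 := fun h => by
    obtain ⟨D, c, hD⟩ := WeakStarFPP.exists_isWeakStarCopy φ h
    exact WeakStarFPP.not_hasFPP_contractive_of_copy φ hD
  tfae_have 2 → 1 := fun h hF => h fun C h1 h2 h3 T hT =>
    hF C h1 h2 h3 T fun x y => (hT x y).le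
  tfae_have 3 → 1 := fun h hF => h fun C h1 h2 h3 T hT =>
    hF C h1 h2 h3 T fun x y => by
      rcases eq_or_ne x y with rfl | hxy
      · simp
      · exact (hT x y hxy).le
  tfae_have 4 → 5 := fun h => by
    obtain ⟨D, c, hD⟩ := WeakStarFPP.exists_isWeakStarCopy φ h
    exact WeakStarFPP.exists_quotient_equiv_of_copy φ hD
  tfae_have 5 → 6 := fun ⟨Y, hY, f, hf, ⟨e⟩⟩ => ⟨Y, hY, f, hf, ⟨e.symm.toLinearIsometry⟩⟩
  tfae_have 6 → 4 := fun ⟨_, _, _, hg, ⟨J⟩⟩ => WeakStarFPP.hasNormOneLimit_of_embedding φ hg J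
  tfae_finish
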